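/- There is an absolute constant $C>0$ such that the following holds. Let $d\in\mathbb N$, let $\mathcal X\subset\mathbb R^d$ be a set with $x^\top y\in[0,1]$ for all $x,y\in\mathcal X$, let $F$ be a probability distribution on $\mathcal X$ whose second moment matrix $\Delta=\mathbb E_{Y\sim F}[YY^\top]$ has rank $d$, and let $(\rho_n)_{n}$ be a sequence with $0<\rho_n\le 1$. For each $n$ let $(X,A)\sim\mathrm{RDPG}(F)$ on $n$ vertices with sparsity factor $\rho_n$; that is, the latent positions $X_1,\dots,X_n$ are i.i.d. with law $F$, and $A\in\{0,1\}^{n\times n}$ is a symmetric matrix with zero diagonal whose conditional distribution given $X=(X_1,\dots,X_n)$ is $$\Pr[A\mid X]=\prod_{i<j}(\rho_n X_i^\top X_j)^{A_{ij}}(1-\rho_n X_i^\top X_j)^{1-A_{ij}} .$$ An adjacency spectral embedding of $A$ into $\mathbb R^d$ (for $n\ge d$) is a matrix $\hat X=U_AS_A^{1/2}\in\mathbb R^{n\times d}$, where $S_A$ is the diagonal matrix of the $d$ largest eigenvalues (with multiplicity, in decreasing order) of $|A|=(A^\top A)^{1/2}$ and the columns of $U_A$ are corresponding orthonormal eigenvectors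 of $|A|$; its $i$-th row is written $\hat X_i$. Let $E_n$ be the event that for every adjacency spectral embedding $\hat X$ of $A$ (i.e. for every choice of the eigenvectors) there is an orthogonal matrix $W\in\mathbb R^{d\times d}$ with $$\max_{1\le i\le n}\bigl\|\hat X_i-\rho_n^{1/2}\,W X_i\bigr\|\le\frac{C\,d^{1/2}\log^2 n}{\sqrt{n\rho_n}} .$$ Then $E_n$ occurs asymptotically almost surely, in the following sense: for every $c>0$ there is $n_0$ such that $\Pr(E_n)\ge 1-\eta$ for all $n>n_0$ and all $\eta$ with $n^{-c}<\eta<1/2$ (in particular $\Pr(E_n)\to1$). -/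

import Mathlib

open MeasureTheory ProbabilityTheory

open scoped Matrix MatrixOrder

noncomputable section

/-- The absolute value `|A| = (Aᵀ A)^{1/2}` of a real square matrix: the positive semidefinite
square root of `Aᵀ A`. -/
def matrixAbs {n : ℕ} (A : Matrix (Fin n) (Fin n) ℝ) : Matrix (Fin n) (Fin n) ℝ :=
  CFC.sqrt (Aᵀ * A)

/-- `Xhat` (given by its rows) is an adjacency spectral embedding `U_A S_A^{1/2}` of `A` into `ℝ^d`:
for some spectral decomposition `|A| = V diag(s) Vᵀ`, with `V` orthogonal and `s` in decreasing
order, `S_A` holds the first `d` eigenvalues and `U_A` the first `d` columns of `V`.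
Eigenvectors are not unique, so this is a relation. -/
def IsASE {n d : ℕ} (A : Matrix (Fin n) (Fin n) ℝ)
    (Xhat : Fin n → EuclideanSpace ℝ (Fin d)) : Prop :=
  ∃ (h : d ≤ n) (V : Matrix (Fin n) (Fin n) ℝ) (s : Fin n → ℝ),
    V ∈ Matrix.orthogonalGroup (Fin n) ℝ ∧ Antitone s ∧
    matrixAbs A = V * Matrix.diagonal s * Vᵀ ∧
    ∀ i k, Xhat i k = V i (Fin.castLE h k) * √(s (Fin.castLE h k))

/-- The second moment matrix `E[X₁ X₁ᵀ]` of a random vector with law `F`. -/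
def secondMoment {d : ℕ} (F : Measure (EuclideanSpace ℝ (Fin d))) : Matrix (Fin d) (Fin d) ℝ :=
  Matrix.of fun j k => ∫ x, x j * x k ∂F

/-- Symmetric hollow matrices with entries in `{0, 1}`. -/
structure IsAdjacency {n : ℕ} (a : Matrix (Fin n) (Fin n) ℝ) : Prop where
  symm : ∀ i j, a i j = a j i
  hollow : ∀ i, a i i = 0
  zero_or_one : ∀ i j, a i j = 0 ∨ a i j = 1

/-- The probability `∏_{i<j} (r xᵢᵀxⱼ)^{a i j} (1 - r xᵢᵀxⱼ)^{1 - a i j}` of the adjacency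
matrix `a` given the latent positions `x` and the sparsity factor `r`. -/
def edgeLikelihood {n d : ℕ} (r : ℝ) (x : Fin n → EuclideanSpace ℝ (Fin d))
    (a : Matrix (Fin n) (Fin n) ℝ) : ℝ :=
  ∏ p : Fin n × Fin n with p.1 < p.2,
    if a p.1 p.2 = 1 then r * inner ℝ (x p.1) (x p.2) else 1 - r * inner ℝ (x p.1) (x p.2)

/-- `(X, A)` is a random dot product graph on `n` vertices with latent position distribution `F`
and sparsity factor `r`: the latent positions are i.i.d. with law `F`, `A` is a random adjacency
matrix, and the conditional probability of `A = a` given `X` is `edgeLikelihood r X a`. -/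
structure IsRDPG {Ω : Type*} [MeasurableSpace Ω] (μ : Measure Ω) {n d : ℕ}
    (F : Measure (EuclideanSpace ℝ (Fin d))) (r : ℝ)
    (X : Ω → Fin n → EuclideanSpace ℝ (Fin d)) (A : Ω → Matrix (Fin n) (Fin n) ℝ) : Prop where
  measurable_pos : ∀ i, Measurable fun ω => X ω i
  law_pos : ∀ i, μ.map (fun ω => X ω i) = F
  indep_pos : iIndepFun (fun i ω => X ω i) μ
  measurable_adj : ∀ i j, Measurable fun ω => A ω i j
  isAdjacency : ∀ ω, IsAdjacency (A ω)
  condProb : ∀ a : Matrix (Fin n) (Fin n) ℝ, IsAdjacency a →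
    μ⟦{ω | A ω = a} | MeasurableSpace.comap X inferInstance⟧
      =ᵐ[μ] fun ω => edgeLikelihood r (X ω) a

/-- The events `E n` occur asymptotically almost surely: for every `c > 0`, for all large `n`,
`P(E n) ≥ 1 - η` whenever `n^{-c} < η < 1/2`. -/
def AsympAlmostSurely {Ω : ℕ → Type*} [∀ n, MeasurableSpace (Ω n)] (μ : ∀ n, Measure (Ω n))
    (E : ∀ n, Set (Ω n)) : Prop :=
  ∀ c : ℝ, 0 < c → ∃ n₀ : ℕ, ∀ n : ℕ, n₀ < n → ∀ η : ℝ,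
    (n : ℝ) ^ (-c) < η → η < 1 / 2 → 1 - η ≤ (μ n).real (E n)

/-- For every adjacency spectral embedding `Xhat` of `A` there is an orthogonal `W` with
`‖Xhat i - r^{1/2} W x i‖ ≤ C d^{1/2} log² n / √(n r)` for all vertices `i`. -/
def EmbeddingErrorBound {n d : ℕ} (C r : ℝ) (x : Fin n → EuclideanSpace ℝ (Fin d))
    (A : Matrix (Fin n) (Fin n) ℝ) : Prop :=
  ∀ Xhat : Fin n → EuclideanSpace ℝ (Fin d), IsASE A Xhat →
    ∃ W ∈ Matrix.orthogonalGroup (Fin d) ℝ, ∀ i,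
      ‖Xhat i - √r • Matrix.toEuclideanLin W (x i)‖
        ≤ C * √d * Real.log n ^ 2 / √(n * r)

end

/-! Let `Y` have rows `r^{1/2} Xᵢ` and let `Z = |A| Z S⁻¹` be a spectral embedding with eigenvalues
`S`. Writing `|A| = Y Yᵀ + D` and substituting this identity into itself once gives
`Z = Y (Yᵀ Z S⁻¹) + D Y (Yᵀ Z S⁻²) + D² Z S⁻²`. Multiplying by the left inverse
`J = (Yᵀ Y)⁻¹ Yᵀ` of `Y` shows that the first term is `Y J Z` up to a small error, and `J Z` is
close to its orthogonal polar factor `W`. So each row of `Z - Y W` is controlled by `‖D‖` and by the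
same row of `D Y`. Here `|A| = A + 2 A⁻`, and since `Y Yᵀ` is positive semidefinite, `A⁻ Y` is of
second order in `A - Y Yᵀ`; hence `D` may be replaced by the noise `A - Y Yᵀ`.

Given the positions, the off-diagonal noise is independent and centered. Counting closed walks in
which no edge is used exactly once bounds the expected traces of its powers, which gives a norm of
order `(n r log n)^{1/2}`; Chernoff bounds control the rows of its product with `Y`; and Hoeffding's
inequality makes `Yᵀ Y` at least a constant times `n r`. This settles the case `n r ≥ log² n`, with
an error of order `log n / (n r)^{1/2}`. If `n r ≤ log² n`, the claimed bound is at least `log n`,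
whereas the rows of `Y` are bounded and `‖Zᵢ‖⁴` is at most the degree of `i`, which is of order
`log² n`. Both cases leave a power of `log n` to spare, so `C = 1` works for large `n`.
-/

section IsometricCalculus

variable {A : Type*} [NormedRing A] [StarRing A] [NormedAlgebra ℝ A] [PartialOrder A]
  [StarOrderedRing A] [IsometricContinuousFunctionalCalculus ℝ A IsSelfAdjoint]
  [NonnegSpectrumClass ℝ A]

lemma norm_sqrt_sub_one_le {a : A} (ha : 0 ≤ a) : ‖CFC.sqrt a - 1‖ ≤ ‖a - 1‖ := by
  have hsa : IsSelfAdjoint a := .of_nonneg ha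
  have hsqrt : CFC.sqrt a - 1 = cfc (fun t : ℝ => √t - 1) a := by
    rw [CFC.sqrt_eq_real_sqrt a, cfcₙ_eq_cfc, cfc_sub _ (fun _ => 1) a, cfc_const_one ℝ a]
  have hid : a - 1 = cfc (fun t : ℝ => t - 1) a := by
    rw [cfc_sub (fun t => t) (fun _ => 1) a, cfc_const_one ℝ a, cfc_id' ℝ a]
  rw [hsqrt, hid]
  refine norm_cfc_le (norm_nonneg _) fun t ht => ?_
  refine le_trans ?_ (norm_apply_le_norm_cfc (fun t : ℝ => t - 1) a ht)
  have ht0 : 0 ≤ t := spectrum_nonneg_of_nonneg ha ht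
  have hfactor : t - 1 = (√t - 1) * (√t + 1) := by linear_combination (Real.sq_sqrt ht0).symm
  rw [hfactor, norm_mul]
  refine le_mul_of_one_le_right (norm_nonneg _) ?_
  rw [Real.norm_of_nonneg (by positivity)]
  linarith [Real.sqrt_nonneg t]

lemma norm_negPart_le_norm_sub {a b : A} (ha : IsSelfAdjoint a) (hb : 0 ≤ b) :
    ‖a⁻‖ ≤ ‖a - b‖ := by
  have hsub : IsSelfAdjoint (a - b) := ha.sub (.of_nonneg hb)
  have hlower : algebraMap ℝ A (-‖a - b‖) ≤ a := by
    refine le_trans ?_ (sub_le_self a hb)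
    refine (algebraMap_le_iff_le_spectrum hsub).mpr fun t ht => ?_
    have := norm_apply_le_norm_cfc id (a - b) ht
    rw [cfc_id ℝ (a - b)] at this
    exact (abs_le.mp this).1
  rw [CFC.negPart_def, cfcₙ_eq_cfc]
  refine norm_cfc_le (norm_nonneg _) fun t ht => ?_
  have := (algebraMap_le_iff_le_spectrum ha).mp hlower t ht
  rw [Real.norm_of_nonneg (negPart_nonneg t)]
  exact sup_le (by linarith) (norm_nonneg _)

lemma norm_negPart_mul_le {a b : A} (ha : IsSelfAdjoint a) (hb : 0 ≤ b) :
    ‖a⁻ * b‖ ≤ 2 * ‖a - b‖ ^ 2 := by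
  have hmul : a⁻ * b = -(a⁻ * a⁻) - a⁻ * (a - b) := by
    have : a⁻ * a = -(a⁻ * a⁻) := by
      nth_rw 2 [← CFC.posPart_sub_negPart a ha]
      rw [mul_sub, CFC.negPart_mul_posPart, zero_sub]
    rw [mul_sub, this]
    abel
  have hneg := norm_negPart_le_norm_sub ha hb
  calc ‖a⁻ * b‖ ≤ ‖a⁻‖ * ‖a⁻‖ + ‖a⁻‖ * ‖a - b‖ := by
        rw [hmul]
        refine (norm_sub_le _ _).trans (add_le_add ?_ (norm_mul_le _ _))
        exact (norm_neg _).trans_le (norm_mul_le _ _)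
    _ ≤ ‖a - b‖ * ‖a - b‖ + ‖a - b‖ * ‖a - b‖ := by gcongr
    _ = 2 * ‖a - b‖ ^ 2 := by ring

end IsometricCalculus

section Matrices

open scoped Matrix.Norms.L2Operator

variable {l m n : Type*} [Fintype m] [Fintype n]

lemma exists_mem_orthogonalGroup_norm_sub_le [DecidableEq n] {N : Matrix n n ℝ}
    (hN : ‖N * Nᵀ - 1‖ < 1) :
    ∃ W ∈ Matrix.orthogonalGroup n ℝ, ‖N - W‖ ≤ ‖N * Nᵀ - 1‖ := by
  have hT : 0 ≤ N * Nᵀ := (Matrix.posSemidef_self_mul_conjTranspose N).nonneg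
  set Q := CFC.sqrt (N * Nᵀ)
  have hQQ : Q * Q = N * Nᵀ := CFC.sqrt_mul_sqrt_self _ hT
  have hQt : Qᵀ = Q := (Matrix.nonneg_iff_posSemidef.mp (CFC.sqrt_nonneg (N * Nᵀ))).1
  have hQ : IsUnit Q.det := by
    have hunit : IsUnit (Q * Q) := by
      have := (Units.oneSub (1 - N * Nᵀ) (by rwa [norm_sub_rev])).isUnit
      rwa [Units.val_oneSub, sub_sub_cancel, ← hQQ] at this
    rw [Matrix.isUnit_iff_isUnit_det, Matrix.det_mul] at hunit
    exact isUnit_of_mul_isUnit_left hunit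
  have hW : Q⁻¹ * N ∈ Matrix.orthogonalGroup n ℝ := by
    rw [Matrix.mem_orthogonalGroup_iff, Matrix.transpose_mul, Matrix.transpose_nonsing_inv, hQt,
      Matrix.mul_assoc, ← Matrix.mul_assoc N, ← hQQ, Matrix.mul_assoc,
      Matrix.mul_nonsing_inv _ hQ, Matrix.mul_one, Matrix.nonsing_inv_mul _ hQ]
  have hpolar : N - Q⁻¹ * N = (Q - 1) * (Q⁻¹ * N) := by
    rw [Matrix.sub_mul, Matrix.mul_nonsing_inv_cancel_left _ _ hQ, Matrix.one_mul]
  have hnorm : ‖(Q - 1) * (Q⁻¹ * N)‖ = ‖Q - 1‖ := CStarRing.norm_mul_mem_unitary _ hW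
  refine ⟨_, hW, ?_⟩
  rw [hpolar, hnorm]
  exact norm_sqrt_sub_one_le hT

lemma l2_opNorm_le_of_norm_mulVec_le [DecidableEq n] {M : Matrix m n ℝ} {c : ℝ} (hc : 0 ≤ c)
    (h : ∀ v : n → ℝ, ‖WithLp.toLp 2 (M *ᵥ v)‖ ≤ c * ‖WithLp.toLp 2 v‖) : ‖M‖ ≤ c := by
  rw [Matrix.l2_opNorm_def]
  exact ContinuousLinearMap.opNorm_le_bound _ hc fun v => h v.ofLp

lemma l2_opNorm_transpose [DecidableEq m] [DecidableEq n] (M : Matrix m n ℝ) : ‖Mᵀ‖ = ‖M‖ := by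
  rw [← Matrix.conjTranspose_eq_transpose_of_trivial, Matrix.l2_opNorm_conjTranspose]

lemma norm_row_mul_le [DecidableEq n] (M : Matrix l m ℝ) (N : Matrix m n ℝ) (i : l) :
    ‖WithLp.toLp 2 ((M * N) i)‖ ≤ ‖WithLp.toLp 2 (M i)‖ * ‖N‖ := by
  classical
  have h := Matrix.l2_opNorm_mulVec Nᵀ (WithLp.toLp 2 (M i))
  rw [l2_opNorm_transpose, mul_comm, Matrix.mulVec_transpose] at h
  exact h

lemma norm_row_le [DecidableEq n] (M : Matrix m n ℝ) (i : m) :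
    ‖WithLp.toLp 2 (M i)‖ ≤ ‖M‖ := by
  classical
  have h := norm_row_mul_le (1 : Matrix m m ℝ) M i
  have hone : WithLp.toLp 2 ((1 : Matrix m m ℝ) i) = EuclideanSpace.single i 1 := by
    ext j
    simp [Matrix.one_apply, eq_comm]
  rwa [Matrix.one_mul, hone, PiLp.norm_single, norm_one, one_mul] at h

lemma norm_row_add_le (M N : Matrix l n ℝ) (i : l) :
    ‖WithLp.toLp 2 ((M + N) i)‖ ≤ ‖WithLp.toLp 2 (M i)‖ + ‖WithLp.toLp 2 (N i)‖ :=
  norm_add_le (WithLp.toLp 2 (M i)) (WithLp.toLp 2 (N i))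

lemma norm_toLp_sq_eq_dotProduct (v : n → ℝ) : ‖WithLp.toLp 2 v‖ ^ 2 = v ⬝ᵥ v := by
  rw [EuclideanSpace.real_norm_sq_eq]
  simp [dotProduct, sq]

lemma norm_toLp_mulVec_sq (M : Matrix m n ℝ) (v : n → ℝ) :
    ‖WithLp.toLp 2 (M *ᵥ v)‖ ^ 2 = v ⬝ᵥ ((Mᵀ * M) *ᵥ v) := by
  rw [norm_toLp_sq_eq_dotProduct, ← Matrix.mulVec_mulVec, Matrix.dotProduct_mulVec v,
    Matrix.vecMul_transpose]

lemma abs_dotProduct_le_norm_mul_norm (v w : n → ℝ) :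
    |v ⬝ᵥ w| ≤ ‖WithLp.toLp 2 v‖ * ‖WithLp.toLp 2 w‖ := by
  have := abs_real_inner_le_norm (WithLp.toLp 2 v) (WithLp.toLp 2 w)
  rwa [EuclideanSpace.inner_toLp_toLp, star_trivial, dotProduct_comm] at this

lemma abs_dotProduct_mulVec_le [DecidableEq n] (M : Matrix n n ℝ) (v : n → ℝ) :
    |v ⬝ᵥ (M *ᵥ v)| ≤ ‖M‖ * (v ⬝ᵥ v) :=
  calc |v ⬝ᵥ (M *ᵥ v)| ≤ ‖WithLp.toLp 2 v‖ * ‖WithLp.toLp 2 (M *ᵥ v)‖ :=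
        abs_dotProduct_le_norm_mul_norm v (M *ᵥ v)
    _ ≤ ‖WithLp.toLp 2 v‖ * (‖M‖ * ‖WithLp.toLp 2 v‖) := by
        gcongr
        exact Matrix.l2_opNorm_mulVec M (WithLp.toLp 2 v)
    _ = ‖M‖ * (v ⬝ᵥ v) := by rw [← norm_toLp_sq_eq_dotProduct]; ring

lemma dotProduct_self_nonneg (v : n → ℝ) : 0 ≤ v ⬝ᵥ v :=
  norm_toLp_sq_eq_dotProduct v ▸ sq_nonneg _

lemma dotProduct_self_pos {v : n → ℝ} (hv : v ≠ 0) : 0 < v ⬝ᵥ v :=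
  (dotProduct_self_nonneg v).lt_of_ne' fun h => hv (dotProduct_self_eq_zero.mp h)

lemma l2_opNorm_transpose_mul_self [DecidableEq n] (U : Matrix m n ℝ) :
    ‖Uᵀ * U‖ = ‖U‖ ^ 2 := by
  rw [← Matrix.conjTranspose_eq_transpose_of_trivial, Matrix.l2_opNorm_conjTranspose_mul_self, sq]

lemma isUnit_det_of_coercive [DecidableEq n] {G : Matrix n n ℝ} {c : ℝ} (hc : 0 < c)
    (hG : ∀ u, c * (u ⬝ᵥ u) ≤ u ⬝ᵥ (G *ᵥ u)) : IsUnit G.det := by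
  refine isUnit_iff_ne_zero.mpr fun hdet => ?_
  obtain ⟨u, hu, hGu⟩ := Matrix.exists_mulVec_eq_zero_iff.mpr hdet
  have := hG u
  rw [hGu, dotProduct_zero] at this
  exact this.not_gt (mul_pos hc (dotProduct_self_pos hu))

lemma l2_opNorm_inv_le_of_coercive [DecidableEq n] {G : Matrix n n ℝ} {c : ℝ} (hc : 0 < c)
    (hG : ∀ u, c * (u ⬝ᵥ u) ≤ u ⬝ᵥ (G *ᵥ u)) : ‖G⁻¹‖ ≤ 1 / c := by
  refine l2_opNorm_le_of_norm_mulVec_le (by positivity) fun v => ?_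
  set w := G⁻¹ *ᵥ v with hw
  have hGw : G *ᵥ w = v := by
    rw [hw, Matrix.mulVec_mulVec, Matrix.mul_nonsing_inv _ (isUnit_det_of_coercive hc hG),
      Matrix.one_mulVec]
  have hcoercive : c * ‖WithLp.toLp 2 w‖ ^ 2 ≤ ‖WithLp.toLp 2 w‖ * ‖WithLp.toLp 2 v‖ := by
    rw [norm_toLp_sq_eq_dotProduct]
    refine (hG w).trans ((le_abs_self _).trans ?_)
    rw [hGw]
    exact abs_dotProduct_le_norm_mul_norm w v
  rw [div_mul_eq_mul_div, one_mul, le_div_iff₀ hc]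
  rcases (norm_nonneg (WithLp.toLp 2 w)).eq_or_lt with hzero | hpos
  · rw [← hzero]
    simp
  · exact le_of_mul_le_mul_left (by linarith) hpos

end Matrices

section MatrixAbs

open scoped Matrix.Norms.L2Operator

variable {n : ℕ} {A P : Matrix (Fin n) (Fin n) ℝ}

lemma matrixAbs_eq_add_negPart (hA : A.IsHermitian) : matrixAbs A = A + 2 • A⁻ := by
  have h := CFC.abs_sub_self A hA
  rwa [sub_eq_iff_eq_add, add_comm, CFC.abs, Matrix.star_eq_conjTranspose,
    Matrix.conjTranspose_eq_transpose_of_trivial] at h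

lemma norm_matrixAbs_sub_le (hA : A.IsHermitian) (hP : P.PosSemidef) :
    ‖matrixAbs A - P‖ ≤ 3 * ‖A - P‖ := by
  have hneg := norm_negPart_le_norm_sub hA hP.nonneg
  calc ‖matrixAbs A - P‖ = ‖(A - P) + (A⁻ + A⁻)‖ := by
        rw [matrixAbs_eq_add_negPart hA, two_smul]
        abel_nf
    _ ≤ ‖A - P‖ + (‖A⁻‖ + ‖A⁻‖) := (norm_add_le _ _).trans (by gcongr; exact norm_add_le _ _)
    _ ≤ 3 * ‖A - P‖ := by linarith

lemma diagonal_nonneg_of_matrixAbs_eq {V : Matrix (Fin n) (Fin n) ℝ} {s : Fin n → ℝ}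
    (hV : Vᵀ * V = 1) (hs : matrixAbs A = V * Matrix.diagonal s * Vᵀ) (j : Fin n) : 0 ≤ s j := by
  have habs : (matrixAbs A).PosSemidef := Matrix.nonneg_iff_posSemidef.mp (CFC.sqrt_nonneg _)
  have hdiag : Vᵀ * matrixAbs A * V = Matrix.diagonal s := by
    rw [hs, Matrix.mul_assoc, Matrix.mul_assoc, Matrix.mul_assoc, hV, Matrix.mul_one,
      ← Matrix.mul_assoc, hV, Matrix.one_mul]
  have := habs.conjTranspose_mul_mul_same V
  rw [Matrix.conjTranspose_eq_transpose_of_trivial, hdiag, Matrix.posSemidef_diagonal_iff] at this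
  exact this j

end MatrixAbs

section GramInverse

open scoped Matrix.Norms.L2Operator

variable {m n : Type*} [Fintype m] [Fintype n] [DecidableEq m] [DecidableEq n] {Y : Matrix m n ℝ}
  {c : ℝ}

lemma l2_opNorm_gram_inv_mul_transpose_le (hc : 0 < c)
    (hG : ∀ u, c * (u ⬝ᵥ u) ≤ u ⬝ᵥ ((Yᵀ * Y) *ᵥ u)) : ‖(Yᵀ * Y)⁻¹ * Yᵀ‖ ≤ ‖Y‖ / c := by
  refine (Matrix.l2_opNorm_mul _ _).trans ?_
  rw [l2_opNorm_transpose, div_eq_mul_one_div, mul_comm]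
  gcongr
  exact l2_opNorm_inv_le_of_coercive hc hG

lemma l2_opNorm_negPart_mul_le {A : Matrix m m ℝ} (hA : A.IsHermitian) (hc : 0 < c)
    (hG : ∀ u, c * (u ⬝ᵥ u) ≤ u ⬝ᵥ ((Yᵀ * Y) *ᵥ u)) :
    ‖A⁻ * Y‖ ≤ 2 * ‖A - Y * Yᵀ‖ ^ 2 * (‖Y‖ / c) := by
  have hP : 0 ≤ Y * Yᵀ := (Matrix.posSemidef_self_mul_conjTranspose Y).nonneg
  have hY : Y * Yᵀ * (Y * (Yᵀ * Y)⁻¹) = Y := by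
    rw [Matrix.mul_assoc, ← Matrix.mul_assoc Yᵀ,
      Matrix.mul_nonsing_inv _ (isUnit_det_of_coercive hc hG), Matrix.mul_one]
  have hinv : ‖Y * (Yᵀ * Y)⁻¹‖ ≤ ‖Y‖ / c := by
    refine (Matrix.l2_opNorm_mul _ _).trans ?_
    rw [div_eq_mul_one_div]
    gcongr
    exact l2_opNorm_inv_le_of_coercive hc hG
  calc ‖A⁻ * Y‖ = ‖A⁻ * (Y * Yᵀ) * (Y * (Yᵀ * Y)⁻¹)‖ := by rw [Matrix.mul_assoc, hY]
    _ ≤ ‖A⁻ * (Y * Yᵀ)‖ * ‖Y * (Yᵀ * Y)⁻¹‖ := Matrix.l2_opNorm_mul _ _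
    _ ≤ 2 * ‖A - Y * Yᵀ‖ ^ 2 * (‖Y‖ / c) := by
        gcongr
        exact norm_negPart_mul_le hA hP

end GramInverse

section RowPerturbation

open scoped Matrix.Norms.L2Operator

variable {m n : Type*} [Fintype m] [Fintype n] [DecidableEq n]
  {B : Matrix m m ℝ} {Y X : Matrix m n ℝ} {T : Matrix n n ℝ} {J : Matrix n m ℝ}

lemma sub_mul_eq_of_mul_mul_eq (hX : B * (X * T) = X) (hJ : J * Y = 1) (W : Matrix n n ℝ) :
    X - Y * W = (B - Y * Yᵀ) * Y * (Yᵀ * (X * T) * T)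
      + (B - Y * Yᵀ) * ((B - Y * Yᵀ) * (X * T)) * T
      - Y * (J * ((B - Y * Yᵀ) * (X * T))) + Y * (J * X - W) := by
  set D := B - Y * Yᵀ with hD
  set R := D * (X * T) with hR
  have hXR : X = Y * (Yᵀ * (X * T)) + R := by
    rw [hR, hD, Matrix.sub_mul, hX, Matrix.mul_assoc, add_sub_cancel]
  have hRR : R = D * Y * (Yᵀ * (X * T) * T) + D * R * T := by
    conv_lhs => rw [hR]; enter [2, 1]; rw [hXR]
    simp only [Matrix.mul_add, Matrix.add_mul, Matrix.mul_assoc]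
  have hJX : Y * (J * X) = X - R + Y * (J * R) := by
    conv_lhs => rw [hXR, Matrix.mul_add, ← Matrix.mul_assoc J, hJ, Matrix.one_mul, Matrix.mul_add]
    rw [eq_sub_of_add_eq hXR.symm]
  rw [← hRR, Matrix.mul_sub, hJX]
  abel

variable [DecidableEq m]

lemma norm_mul_mul_transpose_sub_one_le (hJ : J * Y = 1) :
    ‖J * X * (J * X)ᵀ - 1‖ ≤ ‖J‖ * ‖X * Xᵀ - Y * Yᵀ‖ * ‖J‖ := by
  have hYJ : Yᵀ * Jᵀ = 1 := by rw [← Matrix.transpose_mul, hJ, Matrix.transpose_one]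
  have hfactor : J * X * (J * X)ᵀ - 1 = J * (X * Xᵀ - Y * Yᵀ) * Jᵀ := by
    rw [Matrix.transpose_mul, Matrix.mul_sub, Matrix.sub_mul, ← Matrix.mul_assoc J Y, hJ,
      Matrix.one_mul, hYJ]
    simp only [Matrix.mul_assoc]
  rw [hfactor]
  refine (Matrix.l2_opNorm_mul _ _).trans ?_
  rw [l2_opNorm_transpose]
  gcongr
  exact Matrix.l2_opNorm_mul _ _

lemma exists_orthogonal_norm_row_sub_mul_le {β y z t j κ : ℝ} (hX : B * (X * T) = X)
    (hJ : J * Y = 1) (hB : ‖B - Y * Yᵀ‖ ≤ β) (hXY : ‖X * Xᵀ - Y * Yᵀ‖ ≤ 2 * β) (hY : ‖Y‖ ≤ y)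
    (hz : ‖X * T‖ ≤ z) (hT : ‖T‖ ≤ t) (hj : ‖J‖ ≤ j)
    (hκ : ∀ i, ‖WithLp.toLp 2 (((B - Y * Yᵀ) * Y) i)‖ ≤ κ)
    (hYrow : ∀ i, ‖WithLp.toLp 2 (Y i)‖ ≤ 1) (hsmall : j * (2 * β) * j < 1) :
    ∃ W ∈ Matrix.orthogonalGroup n ℝ, ∀ i, ‖WithLp.toLp 2 ((X - Y * W) i)‖ ≤
      κ * (y * z * t) + β * (β * z) * t + j * (β * z) + j * (2 * β) * j := by
  have hβ0 : 0 ≤ β := (norm_nonneg _).trans hB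
  have hy0 : 0 ≤ y := (norm_nonneg _).trans hY
  have hz0 : 0 ≤ z := (norm_nonneg _).trans hz
  have hj0 : 0 ≤ j := (norm_nonneg _).trans hj
  have hpolar : ‖J * X * (J * X)ᵀ - 1‖ ≤ j * (2 * β) * j :=
    (norm_mul_mul_transpose_sub_one_le hJ).trans (by gcongr)
  obtain ⟨W, hW, hJW⟩ := exists_mem_orthogonalGroup_norm_sub_le (hpolar.trans_lt hsmall)
  refine ⟨W, hW, fun i => ?_⟩
  set D := B - Y * Yᵀ
  have hR : ‖D * (X * T)‖ ≤ β * z := (Matrix.l2_opNorm_mul _ _).trans (by gcongr)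
  have hcoef : ‖Yᵀ * (X * T) * T‖ ≤ y * z * t := by
    refine (Matrix.l2_opNorm_mul _ _).trans ?_
    gcongr
    refine (Matrix.l2_opNorm_mul _ _).trans ?_
    rw [l2_opNorm_transpose]
    gcongr
  have hYmul : ∀ N : Matrix n n ℝ, ‖WithLp.toLp 2 ((Y * N) i)‖ ≤ ‖N‖ := fun N =>
    (norm_row_mul_le Y N i).trans (mul_le_of_le_one_left (norm_nonneg N) (hYrow i))
  have hfirst : ‖WithLp.toLp 2 ((D * Y * (Yᵀ * (X * T) * T)) i)‖ ≤ κ * (y * z * t) :=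
    (norm_row_mul_le _ _ i).trans
      (mul_le_mul (hκ i) hcoef (norm_nonneg _) ((norm_nonneg _).trans (hκ i)))
  have hsecond : ‖WithLp.toLp 2 ((D * (D * (X * T)) * T) i)‖ ≤ β * (β * z) * t := by
    refine (norm_row_le _ i).trans ((Matrix.l2_opNorm_mul _ _).trans ?_)
    gcongr
    exact (Matrix.l2_opNorm_mul _ _).trans (by gcongr)
  have hthird : ‖WithLp.toLp 2 ((Y * (J * (D * (X * T)))) i)‖ ≤ j * (β * z) :=
    (hYmul _).trans ((Matrix.l2_opNorm_mul _ _).trans (by gcongr))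
  have hfourth : ‖WithLp.toLp 2 ((Y * (J * X - W)) i)‖ ≤ j * (2 * β) * j :=
    (hYmul _).trans (hJW.trans hpolar)
  rw [sub_mul_eq_of_mul_mul_eq hX hJ W]
  exact (norm_add_le _ _).trans (add_le_add ((norm_sub_le _ _).trans
    (add_le_add ((norm_add_le _ _).trans (add_le_add hfirst hsecond)) hthird)) hfourth)

end RowPerturbation

section Eigenvalues

open scoped Matrix.Norms.L2Operator

lemma exists_ne_zero_mulVec_eq_zero {K m n : Type*} [Field K] [Fintype m] [Fintype n]
    (hcard : Fintype.card m < Fintype.card n) (M : Matrix m n K) : ∃ v ≠ 0, M *ᵥ v = 0 := by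
  have hker : M.mulVecLin.ker ≠ ⊥ := LinearMap.ker_ne_bot_of_finrank_lt (by simpa using hcard)
  obtain ⟨v, hv, hv0⟩ := (Submodule.ne_bot_iff _).mp hker
  exact ⟨v, hv0, hv⟩

variable {n d : ℕ}

section

variable {m : Type*} [Fintype m] [DecidableEq m]

lemma dotProduct_conj_diagonal_mulVec (V : Matrix m m ℝ) (s v : m → ℝ) :
    v ⬝ᵥ ((V * Matrix.diagonal s * Vᵀ) *ᵥ v) = ∑ j, s j * (Vᵀ *ᵥ v) j ^ 2 := by
  rw [← Matrix.mulVec_mulVec, ← Matrix.mulVec_mulVec, Matrix.dotProduct_mulVec,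
    ← Matrix.mulVec_transpose]
  simp only [dotProduct, Matrix.mulVec_diagonal]
  exact Finset.sum_congr rfl fun j _ => by ring

lemma dotProduct_self_eq_sum_transpose_mulVec_sq {V : Matrix m m ℝ} (hV : V * Vᵀ = 1)
    (v : m → ℝ) : v ⬝ᵥ v = ∑ j, (Vᵀ *ᵥ v) j ^ 2 := by
  simpa [hV] using dotProduct_conj_diagonal_mulVec V 1 v

end

lemma mul_dotProduct_self_mulVec_le {k m : Type*} [Fintype k] [Fintype m] {Y : Matrix m k ℝ}
    {c : ℝ} (hc : 0 ≤ c) (hG : ∀ u, c * (u ⬝ᵥ u) ≤ u ⬝ᵥ ((Yᵀ * Y) *ᵥ u)) (u : k → ℝ) :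
    c * ((Y *ᵥ u) ⬝ᵥ (Y *ᵥ u)) ≤ (Y *ᵥ u) ⬝ᵥ ((Y * Yᵀ) *ᵥ (Y *ᵥ u)) := by
  set w := (Yᵀ * Y) *ᵥ u with hw
  have hYu : (Y *ᵥ u) ⬝ᵥ (Y *ᵥ u) = u ⬝ᵥ w := by
    rw [← norm_toLp_sq_eq_dotProduct, norm_toLp_mulVec_sq]
  have hw2 : (Y *ᵥ u) ⬝ᵥ ((Y * Yᵀ) *ᵥ (Y *ᵥ u)) = w ⬝ᵥ w := by
    rw [← Matrix.mulVec_mulVec, Matrix.dotProduct_mulVec, ← Matrix.mulVec_transpose, hw,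
      Matrix.mulVec_mulVec]
  rw [hYu, hw2]
  have hcauchy : (u ⬝ᵥ w) ^ 2 ≤ (u ⬝ᵥ u) * (w ⬝ᵥ w) := by
    rw [← norm_toLp_sq_eq_dotProduct u, ← norm_toLp_sq_eq_dotProduct w, ← mul_pow, ← sq_abs]
    gcongr
    exact abs_dotProduct_le_norm_mul_norm u w
  have huw : 0 ≤ u ⬝ᵥ w := hYu ▸ dotProduct_self_nonneg _
  rcases huw.eq_or_lt with hzero | hpos
  · rw [← hzero, mul_zero]
    exact dotProduct_self_nonneg w
  · refine le_of_mul_le_mul_left ?_ hpos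
    calc (u ⬝ᵥ w) * (c * (u ⬝ᵥ w)) = c * (u ⬝ᵥ w) ^ 2 := by ring
      _ ≤ c * ((u ⬝ᵥ u) * (w ⬝ᵥ w)) := by gcongr
      _ = c * (u ⬝ᵥ u) * (w ⬝ᵥ w) := by ring
      _ ≤ (u ⬝ᵥ w) * (w ⬝ᵥ w) := by
          gcongr
          · exact dotProduct_self_nonneg w
          · exact hG u

variable {V : Matrix (Fin n) (Fin n) ℝ} {s : Fin n → ℝ} {Y : Matrix (Fin n) (Fin d) ℝ} {k : Fin n}

lemma eigenvalue_le_norm_sub_mul_transpose (hV : V * Vᵀ = 1) (hs : Antitone s) (hk : d ≤ k) :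
    s k ≤ ‖V * Matrix.diagonal s * Vᵀ - Y * Yᵀ‖ := by
  have hV' : Vᵀ * V = 1 := mul_eq_one_comm.mp hV
  let M : Matrix (Fin d ⊕ {j // k < j}) (Fin n) ℝ :=
    Matrix.fromRows (Yᵀ * V) (Matrix.submatrix 1 Subtype.val id)
  have hcard : Fintype.card (Fin d ⊕ {j // k < j}) < Fintype.card (Fin n) := by
    rw [Fintype.card_sum, Fintype.card_fin, Fintype.card_fin, Fintype.card_subtype,
      Finset.filter_lt_eq_Ioi, Fin.card_Ioi]
    omega
  obtain ⟨w, hw0, hw⟩ := exists_ne_zero_mulVec_eq_zero hcard M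
  rw [Matrix.fromRows_mulVec] at hw
  have hYw : (Yᵀ * V) *ᵥ w = 0 := funext fun i => congrFun hw (Sum.inl i)
  have hwj : ∀ j, k < j → w j = 0 := fun j hj => by
    simpa [Matrix.mulVec, dotProduct, Matrix.one_apply] using congrFun hw (Sum.inr ⟨j, hj⟩)
  have hVw : Vᵀ *ᵥ (V *ᵥ w) = w := by rw [Matrix.mulVec_mulVec, hV', Matrix.one_mulVec]
  have hupper :=
    (le_abs_self _).trans (abs_dotProduct_mulVec_le (V * Matrix.diagonal s * Vᵀ - Y * Yᵀ) (V *ᵥ w))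
  rw [Matrix.sub_mulVec, ← Matrix.mulVec_mulVec _ Y, Matrix.mulVec_mulVec w Yᵀ, hYw,
    Matrix.mulVec_zero, sub_zero, dotProduct_conj_diagonal_mulVec,
    dotProduct_self_eq_sum_transpose_mulVec_sq hV, hVw] at hupper
  have hlower : s k * ∑ j, w j ^ 2 ≤ ∑ j, s j * w j ^ 2 := by
    rw [Finset.mul_sum]
    refine Finset.sum_le_sum fun j _ => ?_
    rcases le_or_gt j k with hjk | hjk
    · exact mul_le_mul_of_nonneg_right (hs hjk) (sq_nonneg _)
    · simp [hwj j hjk]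
  have hpos : 0 < ∑ j, w j ^ 2 := by
    simpa [dotProduct, sq] using dotProduct_self_pos hw0
  exact le_of_mul_le_mul_right (hlower.trans hupper) hpos

lemma sub_norm_sub_mul_transpose_le_eigenvalue (hV : V * Vᵀ = 1) (hs : Antitone s) {c : ℝ}
    (hc : 0 < c) (hG : ∀ u, c * (u ⬝ᵥ u) ≤ u ⬝ᵥ ((Yᵀ * Y) *ᵥ u)) (hk : k < d) :
    c - ‖V * Matrix.diagonal s * Vᵀ - Y * Yᵀ‖ ≤ s k := by
  have hcard : Fintype.card {j // j < k} < Fintype.card (Fin d) := by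
    rwa [Fintype.card_fin, Fintype.card_subtype, Finset.filter_gt_eq_Iio, Fin.card_Iio]
  obtain ⟨u, hu0, hu⟩ :=
    exists_ne_zero_mulVec_eq_zero hcard ((Vᵀ * Y).submatrix Subtype.val id)
  set v := Y *ᵥ u with hv
  have hvj : ∀ j, j < k → (Vᵀ *ᵥ v) j = 0 := fun j hj => by
    rw [hv, Matrix.mulVec_mulVec]
    exact congrFun hu ⟨j, hj⟩
  have hvpos : 0 < v ⬝ᵥ v := by
    rw [← norm_toLp_sq_eq_dotProduct, hv, norm_toLp_mulVec_sq]
    exact (mul_pos hc (dotProduct_self_pos hu0)).trans_le (hG u)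
  have hlower :=
    neg_le_of_abs_le (abs_dotProduct_mulVec_le (V * Matrix.diagonal s * Vᵀ - Y * Yᵀ) v)
  rw [Matrix.sub_mulVec, dotProduct_sub, dotProduct_conj_diagonal_mulVec] at hlower
  have hupper : ∑ j, s j * (Vᵀ *ᵥ v) j ^ 2 ≤ s k * (v ⬝ᵥ v) := by
    rw [dotProduct_self_eq_sum_transpose_mulVec_sq hV, Finset.mul_sum]
    refine Finset.sum_le_sum fun j _ => ?_
    rcases le_or_gt k j with hjk | hjk
    · exact mul_le_mul_of_nonneg_right (hs hjk) (sq_nonneg _)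
    · simp [hvj j hjk]
  have hrange := mul_dotProduct_self_mulVec_le hc.le hG u
  refine le_of_mul_le_mul_right ?_ hvpos
  linarith

end Eigenvalues

section SpectralTruncation

open scoped Matrix.Norms.L2Operator

lemma submatrix_mul_diagonal_mul_transpose {k m : Type*} [Fintype k] [Fintype m] [DecidableEq k]
    [DecidableEq m] (V : Matrix m m ℝ) (s : m → ℝ) {e : k → m} (he : Function.Injective e) :
    V.submatrix id e * Matrix.diagonal (s ∘ e) * (V.submatrix id e)ᵀ =
      V * Matrix.diagonal ((Set.range e).indicator s) * Vᵀ := by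
  ext i l
  rw [Matrix.mul_apply, Matrix.mul_apply]
  simp only [Matrix.mul_diagonal, Matrix.transpose_apply]
  refine Fintype.sum_of_injective e he _ _ (fun j hj => ?_) fun a => ?_
  · simp [hj]
  · simp

variable {n d : ℕ} {A : Matrix (Fin n) (Fin n) ℝ}

lemma norm_conj_diagonal_indicator_compl_le {V : Matrix (Fin n) (Fin n) ℝ} (hV : V * Vᵀ = 1)
    {s : Fin n → ℝ} (hs : Antitone s) (hs0 : ∀ j, 0 ≤ s j) (Y : Matrix (Fin n) (Fin d) ℝ)
    (hdn : d ≤ n) :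
    ‖V * Matrix.diagonal ((Set.range (Fin.castLE hdn))ᶜ.indicator s) * Vᵀ‖ ≤
      ‖V * Matrix.diagonal s * Vᵀ - Y * Yᵀ‖ := by
  have hVorth : V ∈ Matrix.orthogonalGroup (Fin n) ℝ := (Matrix.mem_orthogonalGroup_iff _ _).mpr hV
  have hVtorth : Vᵀ ∈ Matrix.orthogonalGroup (Fin n) ℝ := Unitary.star_mem hVorth
  rw [CStarRing.norm_mul_mem_unitary _ hVtorth, CStarRing.norm_mem_unitary_mul _ hVorth,
    Matrix.l2_opNorm_diagonal]
  refine (pi_norm_le_iff_of_nonneg (norm_nonneg _)).mpr fun j => ?_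
  by_cases hj : j ∈ (Set.range (Fin.castLE hdn))ᶜ
  · rw [Set.indicator_of_mem hj, Real.norm_of_nonneg (hs0 j)]
    refine eigenvalue_le_norm_sub_mul_transpose hV hs (not_lt.mp fun hjd => hj ?_)
    exact ⟨⟨j, hjd⟩, rfl⟩
  · rw [Set.indicator_of_notMem hj, norm_zero]
    exact norm_nonneg _

lemma IsASE.exists_eigenvalues {X Y : Matrix (Fin n) (Fin d) ℝ}
    (hX : IsASE A fun i => WithLp.toLp 2 (X i)) {c : ℝ} (hc : 0 < c)
    (hG : ∀ u, c * (u ⬝ᵥ u) ≤ u ⬝ᵥ ((Yᵀ * Y) *ᵥ u)) :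
    ∃ t : Fin d → ℝ, (∀ k, c - ‖matrixAbs A - Y * Yᵀ‖ ≤ t k) ∧ Xᵀ * X = Matrix.diagonal t ∧
      matrixAbs A * X = X * Matrix.diagonal t ∧
      ‖matrixAbs A - X * Xᵀ‖ ≤ ‖matrixAbs A - Y * Yᵀ‖ := by
  obtain ⟨hdn, V, s, hV, hs, hA, hXV⟩ := hX
  rw [Matrix.mem_orthogonalGroup_iff] at hV
  have hV' : Vᵀ * V = 1 := mul_eq_one_comm.mp hV
  have hs0 : ∀ j, 0 ≤ s j := diagonal_nonneg_of_matrixAbs_eq hV' hA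
  set e : Fin d → Fin n := Fin.castLE hdn
  set U := V.submatrix id e with hU
  set r : Fin d → ℝ := fun k => √(s (e k))
  have hrr : Matrix.diagonal r * Matrix.diagonal r = Matrix.diagonal (s ∘ e) := by
    rw [Matrix.diagonal_mul_diagonal]
    exact congrArg Matrix.diagonal (funext fun k => Real.mul_self_sqrt (hs0 _))
  have hXU : X = U * Matrix.diagonal r := by
    ext i k
    rw [Matrix.mul_diagonal]
    exact hXV i k
  have hUU : Uᵀ * U = 1 := by
    rw [hU, Matrix.transpose_submatrix, ← Matrix.submatrix_mul _ _ e id e Function.bijective_id,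
      hV', Matrix.submatrix_one _ (Fin.castLE_injective hdn)]
  have hAU : matrixAbs A * U = U * Matrix.diagonal (s ∘ e) := by
    have hAV : matrixAbs A * V = V * Matrix.diagonal s := by
      rw [hA, Matrix.mul_assoc, hV', Matrix.mul_one]
    ext i k
    have := congrFun (congrFun hAV i) (e k)
    rwa [Matrix.mul_diagonal] at this ⊢
  refine ⟨s ∘ e, fun k => ?_, ?_, ?_, ?_⟩
  · rw [hA]
    exact sub_norm_sub_mul_transpose_le_eigenvalue hV hs hc hG k.isLt
  · rw [hXU, Matrix.transpose_mul, Matrix.diagonal_transpose, Matrix.mul_assoc,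
      ← Matrix.mul_assoc Uᵀ, hUU, Matrix.one_mul, hrr]
  · rw [hXU, ← Matrix.mul_assoc, hAU, Matrix.mul_assoc, Matrix.mul_assoc, ← hrr, Matrix.mul_assoc]
  · have hXX : X * Xᵀ = V * Matrix.diagonal ((Set.range e).indicator s) * Vᵀ := by
      rw [hXU, Matrix.transpose_mul, Matrix.diagonal_transpose, Matrix.mul_assoc,
        ← Matrix.mul_assoc (Matrix.diagonal r), hrr, ← Matrix.mul_assoc]
      exact submatrix_mul_diagonal_mul_transpose V s (Fin.castLE_injective hdn)
    rw [hXX, hA, ← Matrix.sub_mul, ← Matrix.mul_sub, Matrix.diagonal_sub, ← Pi.sub_def,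
      ← Set.indicator_compl]
    exact norm_conj_diagonal_indicator_compl_le hV hs hs0 Y hdn

end SpectralTruncation

section EmbeddingPerturbation

open scoped Matrix.Norms.L2Operator

variable {n d : ℕ} {A : Matrix (Fin n) (Fin n) ℝ} {X Y : Matrix (Fin n) (Fin d) ℝ}

lemma norm_row_matrixAbs_sub_mul_le (hA : A.IsHermitian) {c : ℝ} (hc : 0 < c)
    (hG : ∀ u, c * (u ⬝ᵥ u) ≤ u ⬝ᵥ ((Yᵀ * Y) *ᵥ u)) (i : Fin n) :
    ‖WithLp.toLp 2 (((matrixAbs A - Y * Yᵀ) * Y) i)‖ ≤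
      ‖WithLp.toLp 2 (((A - Y * Yᵀ) * Y) i)‖ + 4 * ‖A - Y * Yᵀ‖ ^ 2 * (‖Y‖ / c) := by
  have hsplit : (matrixAbs A - Y * Yᵀ) * Y = (A - Y * Yᵀ) * Y + (A⁻ * Y + A⁻ * Y) := by
    rw [matrixAbs_eq_add_negPart hA, two_smul]
    simp only [Matrix.sub_mul, Matrix.add_mul]
    abel
  have hneg : ‖WithLp.toLp 2 ((A⁻ * Y + A⁻ * Y) i)‖ ≤ ‖A⁻ * Y‖ + ‖A⁻ * Y‖ :=
    (norm_row_le _ i).trans (norm_add_le _ _)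
  rw [hsplit]
  refine (norm_row_add_le _ _ i).trans (add_le_add_right (hneg.trans ?_) _)
  linarith [l2_opNorm_negPart_mul_le hA hc hG]

lemma IsASE.exists_orthogonal_norm_row_sub_le (hA : A.IsHermitian)
    (hX : IsASE A fun i => WithLp.toLp 2 (X i)) {c y σ τ : ℝ} (hc : 0 < c)
    (hG : ∀ u, c * (u ⬝ᵥ u) ≤ u ⬝ᵥ ((Yᵀ * Y) *ᵥ u)) (hY : ‖Y‖ ≤ y)
    (hYrow : ∀ i, ‖WithLp.toLp 2 (Y i)‖ ≤ 1) (hσ : ‖A - Y * Yᵀ‖ ≤ σ) (hσc : 6 * σ ≤ c)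
    (hτ : ∀ i, ‖WithLp.toLp 2 (((A - Y * Yᵀ) * Y) i)‖ ≤ τ)
    (hsmall : y / c * (2 * (3 * σ)) * (y / c) < 1) :
    ∃ W ∈ Matrix.orthogonalGroup (Fin d) ℝ, ∀ i, ‖WithLp.toLp 2 ((X - Y * W) i)‖ ≤
      (τ + 4 * σ ^ 2 * (y / c)) * (y * √(2 / c) * (2 / c))
        + 3 * σ * (3 * σ * √(2 / c)) * (2 / c) + y / c * (3 * σ * √(2 / c))
        + y / c * (2 * (3 * σ)) * (y / c) := by
  have hβ : ‖matrixAbs A - Y * Yᵀ‖ ≤ 3 * σ :=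
    (norm_matrixAbs_sub_le hA (Matrix.posSemidef_self_mul_conjTranspose Y)).trans
      (mul_le_mul_of_nonneg_left hσ zero_le_three)
  obtain ⟨t, ht, hXX, hAX, hXA⟩ := hX.exists_eigenvalues hc hG
  have htc : ∀ k, c / 2 ≤ t k := fun k => by linarith [ht k]
  have htpos : ∀ k, 0 < t k := fun k => (half_pos hc).trans_le (htc k)
  set T := Matrix.diagonal fun k => (t k)⁻¹ with hT
  have htT : Matrix.diagonal t * T = 1 := by
    rw [hT, Matrix.diagonal_mul_diagonal, ← Matrix.diagonal_one]
    exact congrArg Matrix.diagonal (funext fun k => mul_inv_cancel₀ (htpos k).ne')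
  have hTnorm : ‖T‖ ≤ 2 / c := by
    rw [hT, Matrix.l2_opNorm_diagonal]
    refine (pi_norm_le_iff_of_nonneg (by positivity)).mpr fun k => ?_
    rw [Real.norm_of_nonneg (inv_nonneg.mpr (htpos k).le), ← inv_div]
    exact inv_anti₀ (by positivity) (htc k)
  have hXT : ‖X * T‖ ≤ √(2 / c) := by
    refine Real.le_sqrt_of_sq_le ?_
    rwa [← l2_opNorm_transpose_mul_self, Matrix.transpose_mul, Matrix.mul_assoc,
      ← Matrix.mul_assoc Xᵀ, hXX, htT, Matrix.mul_one, l2_opNorm_transpose]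
  have hXY : ‖X * Xᵀ - Y * Yᵀ‖ ≤ 2 * (3 * σ) := by
    rw [← sub_sub_sub_cancel_left _ _ (matrixAbs A)]
    exact (norm_sub_le _ _).trans (by linarith)
  refine exists_orthogonal_norm_row_sub_mul_le (J := (Yᵀ * Y)⁻¹ * Yᵀ) ?_ ?_ hβ hXY hY hXT
    hTnorm ?_ (fun i => ?_) hYrow hsmall
  · rw [← Matrix.mul_assoc, hAX, Matrix.mul_assoc, htT, Matrix.mul_one]
  · rw [Matrix.mul_assoc, Matrix.nonsing_inv_mul _ (isUnit_det_of_coercive hc hG)]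
  · exact (l2_opNorm_gram_inv_mul_transpose_le hc hG).trans (by gcongr)
  · exact (norm_row_matrixAbs_sub_mul_le hA hc hG i).trans (by gcongr; exact hτ i)

end EmbeddingPerturbation

section BernoulliProduct

variable {ι κ : Type*} [Fintype ι]

/-- The probability that independent Bernoulli variables with parameters `p` take the values `g`. -/
noncomputable def bernoulliWeight (p : ι → ℝ) (g : ι → Bool) : ℝ :=
  ∏ e, if g e then p e else 1 - p e

/-- The deviation from its mean of the Bernoulli variable indexed by `e`, when the variables with
parameters `p` take the values `g`. -/
def centeredBit (p : ι → ℝ) (g : ι → Bool) (e : ι) : ℝ :=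
  (if g e then 1 else 0) - p e

lemma bernoulliWeight_nonneg {p : ι → ℝ} (hp : ∀ e, p e ∈ Set.Icc (0 : ℝ) 1) (g : ι → Bool) :
    0 ≤ bernoulliWeight p g := by
  refine Finset.prod_nonneg fun e _ => ?_
  split_ifs
  · exact (hp e).1
  · exact sub_nonneg.mpr (hp e).2

variable [DecidableEq ι] {p : ι → ℝ}

/-- The expectation of a function of independent Bernoulli variables with parameters `p`, as a
finite weighted sum. -/
noncomputable def bernoulliExpect (p : ι → ℝ) (f : (ι → Bool) → ℝ) : ℝ :=
  ∑ g, bernoulliWeight p g * f g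

/-- The probability of a set of values of independent Bernoulli variables with parameters `p`. -/
noncomputable def bernoulliProb (p : ι → ℝ) (S : Set (ι → Bool)) : ℝ :=
  bernoulliExpect p (S.indicator 1)

lemma bernoulliExpect_mono (hp : ∀ e, p e ∈ Set.Icc (0 : ℝ) 1) {f f' : (ι → Bool) → ℝ}
    (h : f ≤ f') : bernoulliExpect p f ≤ bernoulliExpect p f' :=
  Finset.sum_le_sum fun g _ => mul_le_mul_of_nonneg_left (h g) (bernoulliWeight_nonneg hp g)

lemma bernoulliExpect_sum (s : Finset κ) (f : κ → (ι → Bool) → ℝ) :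
    bernoulliExpect p (fun g => ∑ a ∈ s, f a g) = ∑ a ∈ s, bernoulliExpect p (f a) := by
  simp only [bernoulliExpect, Finset.mul_sum]
  exact Finset.sum_comm

lemma bernoulliExpect_div_const (f : (ι → Bool) → ℝ) (c : ℝ) :
    bernoulliExpect p (fun g => f g / c) = bernoulliExpect p f / c := by
  simp only [bernoulliExpect, Finset.sum_div, mul_div_assoc]

lemma bernoulliExpect_prod (p : ι → ℝ) (h : ι → Bool → ℝ) :
    bernoulliExpect p (fun g => ∏ e, h e (g e)) =
      ∏ e, (p e * h e true + (1 - p e) * h e false) := by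
  have hexpand := Finset.prod_univ_sum (fun _ : ι => (Finset.univ : Finset Bool))
    (fun e b => (if b then p e else 1 - p e) * h e b)
  simp only [Fintype.sum_bool, if_true, Bool.false_eq_true, if_false, Fintype.piFinset_univ]
    at hexpand
  rw [hexpand]
  exact Finset.sum_congr rfl fun g _ => Finset.prod_mul_distrib.symm

lemma bernoulliProb_mono (hp : ∀ e, p e ∈ Set.Icc (0 : ℝ) 1) {S T : Set (ι → Bool)}
    (h : S ⊆ T) : bernoulliProb p S ≤ bernoulliProb p T :=
  bernoulliExpect_mono hp fun g =>
    Set.indicator_le_indicator_of_subset h (fun _ => zero_le_one) g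

lemma bernoulliProb_le_expect_div (hp : ∀ e, p e ∈ Set.Icc (0 : ℝ) 1) {f : (ι → Bool) → ℝ}
    (hf : 0 ≤ f) {s : ℝ} (hs : 0 < s) :
    bernoulliProb p {g | s ≤ f g} ≤ bernoulliExpect p f / s := by
  rw [← bernoulliExpect_div_const]
  exact bernoulliExpect_mono hp <|
    Set.indicator_le' (fun g hg => (one_le_div hs).mpr hg) fun g _ => div_nonneg (hf g) hs.le

end BernoulliProduct

section MixedMoments

lemma card_image_le_of_card_fiber_ne_one {ι κ : Type*} [Fintype κ] [DecidableEq ι]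
    {f : κ → ι} {k : ℕ} (hk : Fintype.card κ ≤ 2 * k) (hf : ∀ a, Finset.card {s | f s = a} ≠ 1) :
    (Finset.univ.image f).card ≤ k := by
  have htwo := Finset.mul_card_image_le_card (f := f) Finset.univ 2 fun a ha => by
    have hne : Finset.card {s | f s = a} ≠ 0 := by
      simpa [Finset.filter_eq_empty_iff] using ha
    have hne' := hf a
    omega
  rw [Finset.card_univ] at htwo
  omega

variable {ι κ : Type*} [Fintype ι] [Fintype κ] [DecidableEq ι] {p : ι → ℝ} {ρ : ℝ}

lemma bernoulliExpect_prod_centeredBit (p : ι → ℝ) (f : κ → ι) :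
    bernoulliExpect p (fun g => ∏ s, centeredBit p g (f s)) =
      ∏ a, (p a * (1 - p a) ^ Finset.card {s | f s = a}
        + (1 - p a) * (-p a) ^ Finset.card {s | f s = a}) := by
  have hfiber : ∀ g, ∏ s, centeredBit p g (f s) =
      ∏ a, centeredBit p g a ^ Finset.card {s | f s = a} := fun g => by
    rw [← Finset.prod_fiberwise' Finset.univ f (centeredBit p g)]
    exact Finset.prod_congr rfl fun a _ => Finset.prod_const _
  have hprod := bernoulliExpect_prod p
    fun a b => ((if b then 1 else 0) - p a) ^ Finset.card {s | f s = a}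
  simp only [if_true, Bool.false_eq_true, if_false, zero_sub] at hprod
  rw [← hprod]
  exact congrArg (bernoulliExpect p) (funext hfiber)

lemma abs_centered_moment_le {q : ℝ} (hq : q ∈ Set.Icc (0 : ℝ) 1) {m : ℕ} (hm : 2 ≤ m) :
    |q * (1 - q) ^ m + (1 - q) * (-q) ^ m| ≤ q := by
  obtain ⟨hq0, hq1⟩ := hq
  have hq1' : 0 ≤ 1 - q := sub_nonneg.mpr hq1
  calc |q * (1 - q) ^ m + (1 - q) * (-q) ^ m|
      ≤ |q * (1 - q) ^ m| + |(1 - q) * (-q) ^ m| := abs_add_le _ _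
    _ = q * (1 - q) ^ m + (1 - q) * q ^ m := by
        rw [abs_mul, abs_mul, abs_pow, abs_pow, abs_neg, abs_of_nonneg hq0, abs_of_nonneg hq1']
    _ ≤ q * (1 - q) ^ 2 + (1 - q) * q ^ 2 := by
        gcongr ?_ * ?_ + ?_ * ?_
        · exact pow_le_pow_of_le_one hq1' (sub_le_self 1 hq0) hm
        · exact pow_le_pow_of_le_one hq0 hq1 hm
    _ ≤ q := by nlinarith [sq_nonneg q]

lemma abs_bernoulliExpect_prod_centeredBit_le (hp : ∀ e, p e ∈ Set.Icc (0 : ℝ) 1)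
    (hρ : ∀ e, p e ≤ ρ) {f : κ → ι} (hf : ∀ a, Finset.card {s | f s = a} ≠ 1) :
    |bernoulliExpect p (fun g => ∏ s, centeredBit p g (f s))| ≤
      ρ ^ (Finset.univ.image f).card := by
  rw [bernoulliExpect_prod_centeredBit, Finset.abs_prod]
  calc _ ≤ ∏ a, (if a ∈ Finset.univ.image f then ρ else 1) := by
        refine Finset.prod_le_prod (fun _ _ => abs_nonneg _) fun a _ => ?_
        split_ifs with ha
        · have hne : Finset.card {s | f s = a} ≠ 0 := by
            simpa [Finset.filter_eq_empty_iff] using ha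
          have hne' := hf a
          exact (abs_centered_moment_le (hp a) (by omega)).trans (hρ a)
        · have hzero : Finset.card {s | f s = a} = 0 := by
            simpa [Finset.filter_eq_empty_iff] using ha
          simp [hzero]
    _ = ρ ^ (Finset.univ.image f).card := by
        rw [Finset.prod_ite_mem, Finset.univ_inter, Finset.prod_const]

/-- If every variable occurs at least twice then at most `k` of them occur, which makes room for
the factor `z ^ (#variables - k) ≥ 1`; a variable that occurs once kills the expectation. -/
lemma abs_bernoulliExpect_prod_centeredBit_le_of_card_le (hp : ∀ e, p e ∈ Set.Icc (0 : ℝ) 1)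
    {z : ℝ} (hρ0 : 0 ≤ ρ) (hρ : ∀ e, p e ≤ ρ) (hz0 : 0 < z) (hz1 : z ≤ 1) {k : ℕ}
    (hk : Fintype.card κ ≤ 2 * k) (f : κ → ι) :
    |bernoulliExpect p (fun g => ∏ s, centeredBit p g (f s))| ≤
      (z ^ k)⁻¹ * (ρ * z) ^ (Finset.univ.image f).card := by
  by_cases hone : ∃ a, Finset.card {s | f s = a} = 1
  · obtain ⟨a, ha⟩ := hone
    rw [bernoulliExpect_prod_centeredBit,
      Finset.prod_eq_zero (Finset.mem_univ a) (by rw [ha]; ring), abs_zero]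
    positivity
  · push Not at hone
    refine (abs_bernoulliExpect_prod_centeredBit_le hp hρ hone).trans ?_
    rw [mul_pow, mul_left_comm]
    refine le_mul_of_one_le_right (by positivity) ?_
    rw [inv_mul_eq_div, one_le_div (by positivity)]
    exact pow_le_pow_of_le_one hz0.le hz1 (card_image_le_of_card_fiber_ne_one hk hone)

end MixedMoments

section Chernoff

variable {ι : Type*} [Fintype ι] [DecidableEq ι] {p : ι → ℝ}

lemma exp_le_one_add_add_sq {x : ℝ} (hx : |x| ≤ 1) : Real.exp x ≤ 1 + x + x ^ 2 := by
  linarith [(abs_le.mp (Real.abs_exp_sub_one_sub_id_le hx)).2]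

lemma bernoulli_mgf_le {q y : ℝ} (hq : q ∈ Set.Icc (0 : ℝ) 1) (hy : |y| ≤ 1) :
    q * Real.exp (y * (1 - q)) + (1 - q) * Real.exp (y * (0 - q)) ≤ Real.exp (y ^ 2 * q) := by
  obtain ⟨hq0, hq1⟩ := hq
  have hq1' : 0 ≤ 1 - q := sub_nonneg.mpr hq1
  have htrue : |y * (1 - q)| ≤ 1 := by
    rw [abs_mul, abs_of_nonneg hq1']
    exact mul_le_one₀ hy hq1' (sub_le_self 1 hq0)
  have hfalse : |y * (0 - q)| ≤ 1 := by
    rw [abs_mul, zero_sub, abs_neg, abs_of_nonneg hq0]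
    exact mul_le_one₀ hy hq0 hq1
  calc _ ≤ q * (1 + y * (1 - q) + (y * (1 - q)) ^ 2)
        + (1 - q) * (1 + y * (0 - q) + (y * (0 - q)) ^ 2) := by
        gcongr
        · exact exp_le_one_add_add_sq htrue
        · exact exp_le_one_add_add_sq hfalse
    _ ≤ y ^ 2 * q + 1 := by nlinarith [mul_nonneg (sq_nonneg y) (sq_nonneg q)]
    _ ≤ Real.exp (y ^ 2 * q) := Real.add_one_le_exp _

lemma bernoulliExpect_exp_linear_le (hp : ∀ e, p e ∈ Set.Icc (0 : ℝ) 1) {ρ : ℝ} (hρ0 : 0 ≤ ρ)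
    (hρ : ∀ e, p e ≤ ρ) {c : ι → ℝ} (hc : ∀ e, |c e| ≤ 1) {Q : ℝ} (hQ : ∑ e, c e ^ 2 ≤ Q) {t : ℝ}
    (ht : |t| ≤ 1) :
    bernoulliExpect p (fun g => Real.exp (t * ∑ e, centeredBit p g e * c e)) ≤
      Real.exp (t ^ 2 * (ρ * Q)) := by
  have hprod : ∀ g, Real.exp (t * ∑ e, centeredBit p g e * c e) =
      ∏ e, Real.exp (t * c e * ((if g e then 1 else 0) - p e)) := fun g => by
    rw [← Real.exp_sum, Finset.mul_sum]
    exact congrArg Real.exp (Finset.sum_congr rfl fun e _ => by rw [centeredBit]; ring)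
  rw [funext hprod, bernoulliExpect_prod p
    fun e b => Real.exp (t * c e * ((if b then 1 else 0) - p e))]
  simp only [if_true, Bool.false_eq_true, if_false]
  calc _ ≤ ∏ e, Real.exp ((t * c e) ^ 2 * p e) := by
        refine Finset.prod_le_prod (fun e _ => ?_) fun e _ => bernoulli_mgf_le (hp e) ?_
        · have := (hp e).1
          have := sub_nonneg.mpr (hp e).2
          positivity
        · rw [abs_mul]
          exact mul_le_one₀ ht (abs_nonneg _) (hc e)
    _ = Real.exp (∑ e, (t * c e) ^ 2 * p e) := (Real.exp_sum _ _).symm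
    _ ≤ Real.exp (∑ e, (t * c e) ^ 2 * ρ) := by
        gcongr with e
        exact hρ e
    _ = Real.exp (t ^ 2 * (ρ * ∑ e, c e ^ 2)) := by
        rw [Finset.mul_sum, Finset.mul_sum]
        exact congrArg Real.exp (Finset.sum_congr rfl fun e _ => by ring)
    _ ≤ Real.exp (t ^ 2 * (ρ * Q)) := by gcongr

lemma bernoulliProb_linear_ge_le (hp : ∀ e, p e ∈ Set.Icc (0 : ℝ) 1) {ρ : ℝ} (hρ0 : 0 ≤ ρ)
    (hρ : ∀ e, p e ≤ ρ) {c : ι → ℝ} (hc : ∀ e, |c e| ≤ 1) {Q : ℝ} (hQ : ∑ e, c e ^ 2 ≤ Q) {t : ℝ}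
    (ht0 : 0 ≤ t) (ht1 : t ≤ 1) (s : ℝ) :
    bernoulliProb p {g | s ≤ ∑ e, centeredBit p g e * c e} ≤
      Real.exp (t ^ 2 * (ρ * Q) - t * s) := by
  calc bernoulliProb p {g | s ≤ ∑ e, centeredBit p g e * c e}
      ≤ bernoulliProb p {g | Real.exp (t * s) ≤
          Real.exp (t * ∑ e, centeredBit p g e * c e)} :=
        bernoulliProb_mono hp fun g hg =>
          Real.exp_le_exp.mpr (mul_le_mul_of_nonneg_left hg ht0)
    _ ≤ bernoulliExpect p (fun g => Real.exp (t * ∑ e, centeredBit p g e * c e))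
          / Real.exp (t * s) :=
        bernoulliProb_le_expect_div hp (fun _ => (Real.exp_pos _).le) (Real.exp_pos _)
    _ ≤ Real.exp (t ^ 2 * (ρ * Q)) / Real.exp (t * s) := by
        gcongr
        exact bernoulliExpect_exp_linear_le hp hρ0 hρ hc hQ (abs_le.mpr ⟨by linarith, ht1⟩)
    _ = Real.exp (t ^ 2 * (ρ * Q) - t * s) := (Real.exp_sub _ _).symm

end Chernoff

section Walks

variable {V : Type*}

lemma sum_fin_succ_pi {M : Type*} [AddCommMonoid M] [Fintype V] {m : ℕ}
    (f : (Fin (m + 1) → V) → M) :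
    ∑ w, f w = ∑ w : Fin m → V, ∑ v, f (Fin.snoc w v) := by
  rw [← (Fin.snocEquiv fun _ => V).sum_comp, Fintype.sum_prod_type_right]
  rfl

variable [DecidableEq V]

lemma pow_apply_eq_sum_walks {R : Type*} [CommSemiring R] [Fintype V] (B : Matrix V V R) (m : ℕ)
    (i j : V) :
    (B ^ m) i j = ∑ w : Fin (m + 1) → V, if w 0 = i ∧ w (Fin.last m) = j then
      ∏ s : Fin m, B (w s.castSucc) (w s.succ) else 0 := by
  induction m generalizing j with
  | zero =>
    rw [← (Equiv.funUnique (Fin 1) V).symm.sum_comp]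
    simp [Matrix.one_apply, ite_and]
  | succ m ih =>
    rw [pow_succ, Matrix.mul_apply, sum_fin_succ_pi]
    simp only [ih, Finset.sum_mul]
    rw [Finset.sum_comm]
    refine Finset.sum_congr rfl fun w _ => ?_
    simp [Fin.prod_univ_castSucc, ← Fin.castSucc_succ, ite_and, ite_mul]

lemma trace_pow_eq_sum_closed_walks {R : Type*} [CommSemiring R] [Fintype V] (B : Matrix V V R)
    (m : ℕ) :
    (B ^ m).trace = ∑ w : Fin (m + 1) → V, if w (Fin.last m) = w 0 then
      ∏ s : Fin m, B (w s.castSucc) (w s.succ) else 0 := by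
  simp only [Matrix.trace, Matrix.diag_apply, pow_apply_eq_sum_walks]
  rw [Finset.sum_comm]
  simp [ite_and]

/-- The unordered pairs of consecutive vertices of a walk, which is encoded as its sequence of
vertices; steps that stay at a vertex are allowed. -/
def walkEdges {m : ℕ} (w : Fin (m + 1) → V) : Finset (Sym2 V) :=
  Finset.univ.image fun s : Fin m => s(w s.castSucc, w s.succ)

lemma walkEdges_snoc {m : ℕ} (w : Fin (m + 1) → V) (v : V) :
    walkEdges (Fin.snoc w v : Fin (m + 2) → V) = insert s(w (Fin.last m), v) (walkEdges w) := by
  ext a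
  simp [walkEdges, Fin.exists_fin_succ', ← Fin.castSucc_succ, or_comm, eq_comm]

lemma notMem_walkEdges_of_forall_ne {m : ℕ} {w : Fin (m + 1) → V} {v : V} (hv : ∀ s, w s ≠ v)
    (u : V) : s(u, v) ∉ walkEdges w := by
  intro hmem
  obtain ⟨s, -, hs⟩ := Finset.mem_image.mp hmem
  rcases Sym2.mem_iff.mp (hs ▸ Sym2.mem_mk_right u v) with h | h
  · exact hv _ h.symm
  · exact hv _ h.symm

lemma pow_card_walkEdges_snoc_le {y : ℝ} (hy0 : 0 ≤ y) (hy1 : y ≤ 1) {m : ℕ}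
    (w : Fin (m + 1) → V) (v : V) :
    y ^ (walkEdges (Fin.snoc w v : Fin (m + 2) → V)).card ≤
      y ^ (walkEdges w).card * (y + if v ∈ Finset.univ.image w then 1 else 0) := by
  rw [walkEdges_snoc]
  split_ifs with hv
  · exact (pow_le_pow_of_le_one hy0 hy1 (Finset.card_le_card (Finset.subset_insert _ _))).trans
      (le_mul_of_one_le_right (by positivity) (by linarith))
  · have hnew : s(w (Fin.last m), v) ∉ walkEdges w :=
      notMem_walkEdges_of_forall_ne (by simpa using hv) _
    rw [Finset.card_insert_of_notMem hnew, pow_succ, add_zero]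

/-- Extending a walk by a vertex costs a factor `y` for a new vertex, which brings a new edge, and
the at most `l + 1` vertices already visited are counted with factor `1`. -/
lemma sum_pow_card_walkEdges_le [Fintype V] {y : ℝ} (hy0 : 0 ≤ y) (hy1 : y ≤ 1) (m : ℕ) :
    ∑ w : Fin (m + 1) → V, y ^ (walkEdges w).card ≤
      Fintype.card V * ∏ l ∈ Finset.range m, (Fintype.card V * y + (l + 1)) := by
  induction m with
  | zero => simp [walkEdges]
  | succ m ih =>
    rw [sum_fin_succ_pi, Finset.prod_range_succ, ← mul_assoc]
    refine le_trans ?_ (mul_le_mul_of_nonneg_right ih (by positivity))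
    rw [Finset.sum_mul]
    refine Finset.sum_le_sum fun w _ => ?_
    have hvisited : ((Finset.univ.image w).card : ℝ) ≤ m + 1 := by
      have := Finset.card_image_le (s := Finset.univ) (f := w)
      rw [Finset.card_univ, Fintype.card_fin] at this
      exact_mod_cast this
    calc ∑ v, y ^ (walkEdges (Fin.snoc w v : Fin (m + 2) → V)).card
        ≤ ∑ v, y ^ (walkEdges w).card * (y + if v ∈ Finset.univ.image w then 1 else 0) :=
          Finset.sum_le_sum fun v _ => pow_card_walkEdges_snoc_le hy0 hy1 w v
      _ = y ^ (walkEdges w).card * (Fintype.card V * y + (Finset.univ.image w).card) := by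
          rw [← Finset.mul_sum, Finset.sum_add_distrib, Finset.sum_const, Finset.card_univ,
            nsmul_eq_mul, Finset.sum_boole, Finset.filter_univ_mem]
      _ ≤ y ^ (walkEdges w).card * (Fintype.card V * y + (m + 1)) := by gcongr

end Walks

section HollowMatrices

variable {V : Type*}

/-- The edges of the complete graph on `V`, the indices of the independent entries of the adjacency
matrix of a random graph. -/
abbrev Edge (V : Type*) : Type _ := {e : Sym2 V // ¬ e.IsDiag}

/-- The edge between two distinct vertices. -/
def Edge.mk {i j : V} (h : i ≠ j) : Edge V := ⟨s(i, j), by simpa using h⟩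

variable [DecidableEq V]

/-- The symmetric matrix with zero diagonal and off-diagonal entries `c`. -/
def hollowMatrix {R : Type*} [Zero R] (c : Edge V → R) : Matrix V V R :=
  Matrix.of fun i j => if h : i ≠ j then c (Edge.mk h) else 0

lemma hollowMatrix_apply_of_ne {R : Type*} [Zero R] (c : Edge V → R) {i j : V} (h : i ≠ j) :
    hollowMatrix c i j = c (Edge.mk h) :=
  dif_pos h

lemma hollowMatrix_apply_self {R : Type*} [Zero R] (c : Edge V → R) (i : V) :
    hollowMatrix c i i = 0 :=
  dif_neg (not_not_intro rfl)

lemma hollowMatrix_apply_comm {R : Type*} [Zero R] (c : Edge V → R) (i j : V) :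
    hollowMatrix c i j = hollowMatrix c j i := by
  rcases eq_or_ne i j with rfl | h
  · rfl
  · rw [hollowMatrix_apply_of_ne c h, hollowMatrix_apply_of_ne c h.symm]
    exact congrArg c (Subtype.ext Sym2.eq_swap)

variable [Fintype V] {p : Edge V → ℝ} {ρ : ℝ}

lemma abs_bernoulliExpect_walk_le (hp : ∀ e, p e ∈ Set.Icc (0 : ℝ) 1) {z : ℝ} (hρ0 : 0 ≤ ρ)
    (hρ : ∀ e, p e ≤ ρ) (hz0 : 0 < z) (hz1 : z ≤ 1) {k : ℕ} (w : Fin (2 * k + 1) → V) :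
    |bernoulliExpect p fun g =>
        ∏ s : Fin (2 * k), hollowMatrix (centeredBit p g) (w s.castSucc) (w s.succ)| ≤
      (z ^ k)⁻¹ * (ρ * z) ^ (walkEdges w).card := by
  by_cases hloop : ∃ s : Fin (2 * k), w s.castSucc = w s.succ
  · obtain ⟨s, hs⟩ := hloop
    have hzero : ∀ g, ∏ s : Fin (2 * k),
        hollowMatrix (centeredBit p g) (w s.castSucc) (w s.succ) = 0 := fun g =>
      Finset.prod_eq_zero (Finset.mem_univ s) (by rw [hs, hollowMatrix_apply_self])
    simp only [hzero, bernoulliExpect, mul_zero, Finset.sum_const_zero, abs_zero]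
    positivity
  · push Not at hloop
    have hcard : (walkEdges w).card = (Finset.univ.image fun s => Edge.mk (hloop s)).card := by
      rw [← Finset.card_image_of_injective _ Subtype.val_injective, Finset.image_image]
      rfl
    simp only [hollowMatrix_apply_of_ne _ (hloop _), hcard]
    exact abs_bernoulliExpect_prod_centeredBit_le_of_card_le hp hρ0 hρ hz0 hz1
      (Fintype.card_fin _).le _

lemma bernoulliExpect_trace_pow_le_sum_walks (hp : ∀ e, p e ∈ Set.Icc (0 : ℝ) 1) {z : ℝ}
    (hρ0 : 0 ≤ ρ) (hρ : ∀ e, p e ≤ ρ) (hz0 : 0 < z) (hz1 : z ≤ 1) (k : ℕ) :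
    bernoulliExpect p (fun g => (hollowMatrix (centeredBit p g) ^ (2 * k)).trace) ≤
      (z ^ k)⁻¹ * ∑ w : Fin (2 * k + 1) → V, (ρ * z) ^ (walkEdges w).card := by
  simp only [trace_pow_eq_sum_closed_walks]
  rw [bernoulliExpect_sum, Finset.mul_sum]
  refine Finset.sum_le_sum fun w _ => ?_
  split_ifs
  · exact (le_abs_self _).trans (abs_bernoulliExpect_walk_le hp hρ0 hρ hz0 hz1 w)
  · simp only [bernoulliExpect, mul_zero, Finset.sum_const_zero]
    positivity

lemma bernoulliExpect_trace_pow_le (hp : ∀ e, p e ∈ Set.Icc (0 : ℝ) 1) (hρ0 : 0 < ρ) (hρ1 : ρ ≤ 1)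
    (hρ : ∀ e, p e ≤ ρ) {k : ℕ} (hk : 0 < k) (hkn : 2 * k ≤ Fintype.card V * ρ) :
    bernoulliExpect p (fun g => (hollowMatrix (centeredBit p g) ^ (2 * k)).trace) ≤
      Fintype.card V * (8 * k * (Fintype.card V * ρ)) ^ k := by
  have hk0 : (0 : ℝ) < k := by exact_mod_cast hk
  have hnρ : (0 : ℝ) < Fintype.card V * ρ := by linarith
  -- With this `z`, the factor `card V * (ρ * z)` for a new vertex equals the length of the walk.
  obtain ⟨z, hz⟩ : ∃ z : ℝ, z = 2 * k / (Fintype.card V * ρ) := ⟨_, rfl⟩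
  have hz0 : 0 < z := hz ▸ by positivity
  have hz1 : z ≤ 1 := hz ▸ (div_le_one hnρ).mpr hkn
  have hnew : Fintype.card V * (ρ * z) = 2 * k := by
    rw [← mul_assoc, hz, mul_div_cancel₀ _ hnρ.ne']
  calc bernoulliExpect p (fun g => (hollowMatrix (centeredBit p g) ^ (2 * k)).trace)
      ≤ (z ^ k)⁻¹ * ∑ w : Fin (2 * k + 1) → V, (ρ * z) ^ (walkEdges w).card :=
        bernoulliExpect_trace_pow_le_sum_walks hp hρ0.le hρ hz0 hz1 k
    _ ≤ (z ^ k)⁻¹ * (Fintype.card V *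
          ∏ l ∈ Finset.range (2 * k), (Fintype.card V * (ρ * z) + (l + 1))) := by
        gcongr
        exact sum_pow_card_walkEdges_le (by positivity) (mul_le_one₀ hρ1 hz0.le hz1) _
    _ ≤ (z ^ k)⁻¹ * (Fintype.card V * ∏ l ∈ Finset.range (2 * k), (4 * k : ℝ)) := by
        gcongr with l hl
        have hl' : (l : ℝ) + 1 ≤ 2 * k := by exact_mod_cast Finset.mem_range.mp hl
        linarith
    _ = Fintype.card V * (z⁻¹ * (4 * k) ^ 2) ^ k := by
        rw [Finset.prod_const, Finset.card_range, pow_mul, mul_left_comm, ← inv_pow, ← mul_pow]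
    _ = Fintype.card V * (8 * k * (Fintype.card V * ρ)) ^ k := by
        congr 2
        rw [hz, inv_div]
        field_simp
        ring

end HollowMatrices

section TraceNorm

open scoped Matrix.Norms.L2Operator

variable {m n : Type*} [Fintype m] [Fintype n] [DecidableEq n]

lemma l2_opNorm_sq_le_trace (M : Matrix m n ℝ) : ‖M‖ ^ 2 ≤ (Mᵀ * M).trace := by
  have htrace : (Mᵀ * M).trace = ∑ i, ∑ j, M i j ^ 2 := by
    simp only [Matrix.trace, Matrix.diag_apply, Matrix.mul_apply, Matrix.transpose_apply, ← sq]
    exact Finset.sum_comm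
  have htrace0 : 0 ≤ (Mᵀ * M).trace := by rw [htrace]; positivity
  refine (Real.le_sqrt (norm_nonneg _) htrace0).mp <|
    l2_opNorm_le_of_norm_mulVec_le (Real.sqrt_nonneg _) fun v => ?_
  refine abs_le_of_sq_le_sq' ?_ (by positivity) |>.2
  rw [mul_pow, Real.sq_sqrt htrace0, htrace, EuclideanSpace.real_norm_sq_eq,
    EuclideanSpace.real_norm_sq_eq, Finset.sum_mul]
  exact Finset.sum_le_sum fun i _ => Finset.sum_mul_sq_le_sq_mul_sq Finset.univ (M i) v

lemma l2_opNorm_pow_le_trace {H : Matrix n n ℝ} (hH : H.IsHermitian) (j : ℕ) :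
    ‖H‖ ^ (2 * 2 ^ j) ≤ (H ^ (2 * 2 ^ j)).trace := by
  have hnorm : ‖H ^ 2 ^ j‖ = ‖H‖ ^ 2 ^ j := IsSelfAdjoint.norm_pow_two_pow hH j
  have hHt : Hᵀ = H := by simpa using hH.eq
  have hsq := l2_opNorm_sq_le_trace (H ^ 2 ^ j)
  rwa [hnorm, Matrix.transpose_pow, hHt, ← pow_mul, ← pow_add, ← two_mul, mul_comm] at hsq

lemma trace_pow_nonneg {H : Matrix n n ℝ} (hH : H.IsHermitian) {k : ℕ} (hk : Even k) :
    0 ≤ (H ^ k).trace := by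
  obtain ⟨j, rfl⟩ := hk
  rw [pow_add]
  nth_rw 1 [← (hH.pow j).eq]
  exact (Matrix.posSemidef_conjTranspose_mul_self (H ^ j)).trace_nonneg

end TraceNorm

section Incidence

variable {V : Type*} [Fintype V] [DecidableEq V]

/-- The coefficient of `c e` in the linear form `c ↦ (hollowMatrix c *ᵥ a) i`. -/
def incidenceCoeff {R : Type*} [AddCommMonoid R] (i : V) (a : V → R) (e : Edge V) : R :=
  ∑ j, if s(i, j) = e.1 then a j else 0

lemma hollowMatrix_mulVec_apply {R : Type*} [NonUnitalNonAssocSemiring R] (c : Edge V → R)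
    (i : V) (a : V → R) : (hollowMatrix c *ᵥ a) i = ∑ e, c e * incidenceCoeff i a e := by
  have hentry : ∀ j, hollowMatrix c i j * a j =
      ∑ e, c e * if s(i, j) = e.1 then a j else 0 := fun j => by
    rcases eq_or_ne i j with rfl | h
    · rw [hollowMatrix_apply_self, zero_mul]
      refine (Finset.sum_eq_zero fun e _ => ?_).symm
      rw [if_neg fun he : s(i, i) = e.1 => e.2 (he ▸ Sym2.mk_isDiag_iff.mpr rfl), mul_zero]
    · rw [hollowMatrix_apply_of_ne c h, Finset.sum_eq_single (Edge.mk h)]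
      · simp [Edge.mk]
      · intro e _ he
        rw [if_neg fun hij => he (Subtype.ext hij.symm), mul_zero]
      · exact fun hmem => absurd (Finset.mem_univ _) hmem
  simp only [Matrix.mulVec, dotProduct, hentry, incidenceCoeff, Finset.mul_sum]
  exact Finset.sum_comm

lemma abs_incidenceCoeff_le_sum {a : V → ℝ} (ha : ∀ j, |a j| ≤ 1) (i : V) (e : Edge V) :
    |incidenceCoeff i a e| ≤ ∑ j, if s(i, j) = e.1 then 1 else 0 := by
  refine (Finset.abs_sum_le_sum_abs _ _).trans (Finset.sum_le_sum fun j _ => ?_)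
  split_ifs
  · exact ha j
  · exact abs_zero.le

lemma abs_incidenceCoeff_le_one {a : V → ℝ} (ha : ∀ j, |a j| ≤ 1) (i : V) (e : Edge V) :
    |incidenceCoeff i a e| ≤ 1 := by
  refine (abs_incidenceCoeff_le_sum ha i e).trans ?_
  rw [Finset.sum_boole, Nat.cast_le_one]
  refine Finset.card_le_one.mpr fun j hj l hl => (Sym2.congr_right (a := i)).mp ?_
  exact (Finset.mem_filter.mp hj).2.trans (Finset.mem_filter.mp hl).2.symm

lemma sum_incidenceCoeff_sq_le {a : V → ℝ} (ha : ∀ j, |a j| ≤ 1) (i : V) :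
    ∑ e, incidenceCoeff i a e ^ 2 ≤ Fintype.card V := by
  calc ∑ e, incidenceCoeff i a e ^ 2
      ≤ ∑ e : Edge V, ∑ j, if s(i, j) = e.1 then (1 : ℝ) else 0 := by
        refine Finset.sum_le_sum fun e _ => ?_
        rw [← sq_abs]
        exact (pow_le_of_le_one (abs_nonneg _) (abs_incidenceCoeff_le_one ha i e)
          two_ne_zero).trans (abs_incidenceCoeff_le_sum ha i e)
    _ = ∑ j, ∑ e : Edge V, if s(i, j) = e.1 then (1 : ℝ) else 0 := Finset.sum_comm
    _ ≤ ∑ _j : V, 1 := by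
        refine Finset.sum_le_sum fun j _ => ?_
        rw [Finset.sum_boole, Nat.cast_le_one]
        refine Finset.card_le_one.mpr fun e he e' he' => Subtype.ext ?_
        exact (Finset.mem_filter.mp he).2.symm.trans (Finset.mem_filter.mp he').2
    _ = Fintype.card V := by simp

lemma bernoulliProb_hollowMatrix_mulVec_ge_le {p : Edge V → ℝ}
    (hp : ∀ e, p e ∈ Set.Icc (0 : ℝ) 1) {ρ : ℝ} (hρ0 : 0 ≤ ρ) (hρ : ∀ e, p e ≤ ρ) (i : V)
    {a : V → ℝ} (ha : ∀ j, |a j| ≤ 1) {t : ℝ} (ht0 : 0 ≤ t) (ht1 : t ≤ 1) (s : ℝ) :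
    bernoulliProb p {g | s ≤ (hollowMatrix (centeredBit p g) *ᵥ a) i} ≤
      Real.exp (t ^ 2 * (ρ * Fintype.card V) - t * s) := by
  simp only [hollowMatrix_mulVec_apply]
  exact bernoulliProb_linear_ge_le hp hρ0 hρ (abs_incidenceCoeff_le_one ha i)
    (sum_incidenceCoeff_sq_le ha i) ht0 ht1 s

end Incidence

section RandomGraphs

variable {V E : Type*} [NormedAddCommGroup E] [InnerProductSpace ℝ E]

/-- The edge probabilities of a random dot product graph with latent positions `x` and sparsity
factor `r`. -/
noncomputable def edgeProb (r : ℝ) (x : V → E) (e : Edge V) : ℝ :=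
  r * Sym2.lift ⟨fun i j => inner ℝ (x i) (x j), fun _ _ => real_inner_comm _ _⟩ e.1

lemma edgeProb_mk (r : ℝ) (x : V → E) {i j : V} (h : i ≠ j) :
    edgeProb r x (Edge.mk h) = r * inner ℝ (x i) (x j) :=
  rfl

lemma Edge.forall_iff {P : Edge V → Prop} : (∀ e, P e) ↔ ∀ (i j : V) (h : i ≠ j), P (Edge.mk h) :=
  ⟨fun hP i j h => hP _, fun hP ⟨e, he⟩ => by
    induction e with | h i j => exact hP i j (by simpa using he)⟩

variable [DecidableEq V]

/-- The adjacency matrix of the graph with edge set `g`. -/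
def bitAdjacency (g : Edge V → Bool) : Matrix V V ℝ :=
  hollowMatrix fun e => if g e then 1 else 0

/-- The deviation of the adjacency matrix `a` of a random dot product graph from its conditional
mean given the latent positions `x`. -/
noncomputable def centeredAdjacency (r : ℝ) (x : V → E) (a : Matrix V V ℝ) : Matrix V V ℝ :=
  a - hollowMatrix (edgeProb r x)

lemma centeredAdjacency_bitAdjacency (r : ℝ) (x : V → E) (g : Edge V → Bool) :
    centeredAdjacency r x (bitAdjacency g) = hollowMatrix (centeredBit (edgeProb r x) g) := by
  ext i j
  rw [centeredAdjacency, bitAdjacency, Matrix.sub_apply]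
  rcases eq_or_ne i j with rfl | h
  · simp only [hollowMatrix_apply_self, sub_zero]
  · simp only [hollowMatrix_apply_of_ne _ h, centeredBit]

end RandomGraphs

section ConditionalProbability

variable {n d : ℕ}

lemma isAdjacency_bitAdjacency (g : Edge (Fin n) → Bool) : IsAdjacency (bitAdjacency g) where
  symm := hollowMatrix_apply_comm _
  hollow := hollowMatrix_apply_self _
  zero_or_one i j := by
    rcases eq_or_ne i j with rfl | h
    · exact Or.inl (hollowMatrix_apply_self _ i)
    · rw [bitAdjacency, hollowMatrix_apply_of_ne _ h]
      exact (ite_eq_or_eq _ _ _).symm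

lemma IsAdjacency.exists_bitAdjacency_eq {a : Matrix (Fin n) (Fin n) ℝ} (ha : IsAdjacency a) :
    ∃ g, bitAdjacency g = a := by
  refine ⟨fun e => decide (Sym2.lift ⟨a, ha.symm⟩ e.1 = 1), ?_⟩
  ext i j
  rcases eq_or_ne i j with rfl | h
  · rw [ha.hollow, bitAdjacency, hollowMatrix_apply_self]
  · rw [bitAdjacency, hollowMatrix_apply_of_ne _ h]
    rcases ha.zero_or_one i j with h01 | h01 <;> simp [Edge.mk, h01]

lemma edgeLikelihood_bitAdjacency (r : ℝ) (x : Fin n → EuclideanSpace ℝ (Fin d))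
    (g : Edge (Fin n) → Bool) :
    edgeLikelihood r x (bitAdjacency g) = bernoulliWeight (edgeProb r x) g := by
  refine Finset.prod_bij (fun p hp => Edge.mk (Finset.mem_filter.mp hp).2.ne)
    (fun _ _ => Finset.mem_univ _) (fun p hp q hq hpq => ?_) (fun e _ => ?_) fun p hp => ?_
  · rcases Sym2.eq_iff.mp (congrArg Subtype.val hpq) with h | h
    · exact Prod.ext h.1 h.2
    · have hp' := (Finset.mem_filter.mp hp).2
      rw [h.1, h.2] at hp'
      exact absurd hp' (Finset.mem_filter.mp hq).2.asymm
  · revert e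
    refine Edge.forall_iff.mpr fun i j h _ => ?_
    rcases h.lt_or_gt with hlt | hlt
    · exact ⟨(i, j), by simpa using hlt, rfl⟩
    · exact ⟨(j, i), by simpa using hlt, Subtype.ext Sym2.eq_swap⟩
  · have hne := (Finset.mem_filter.mp hp).2.ne
    rw [bitAdjacency, hollowMatrix_apply_of_ne _ hne, edgeProb_mk]
    cases g (Edge.mk hne) <;> simp

variable {Ω : Type*} [MeasurableSpace Ω] {μ : Measure Ω} {F : Measure (EuclideanSpace ℝ (Fin d))}
  {r : ℝ} {X : Ω → Fin n → EuclideanSpace ℝ (Fin d)} {A : Ω → Matrix (Fin n) (Fin n) ℝ}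

lemma IsRDPG.measurable_positions (h : IsRDPG μ F r X A) : Measurable X :=
  measurable_pi_lambda _ h.measurable_pos

lemma IsRDPG.measurableSet_adj_eq (h : IsRDPG μ F r X A) (a : Matrix (Fin n) (Fin n) ℝ) :
    MeasurableSet {ω | A ω = a} := by
  have hentries : {ω | A ω = a} = ⋂ i, ⋂ j, {ω | A ω i j = a i j} := by
    ext ω
    simp only [Set.mem_iInter, Set.mem_ofPred_eq, ← Matrix.ext_iff]
  rw [hentries]
  exact MeasurableSet.iInter fun i => MeasurableSet.iInter fun j =>
    measurableSet_eq_fun (h.measurable_adj i j) measurable_const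

lemma IsRDPG.integrable_edgeLikelihood (h : IsRDPG μ F r X A) {a : Matrix (Fin n) (Fin n) ℝ}
    (ha : IsAdjacency a) : Integrable (fun ω => edgeLikelihood r (X ω) a) μ :=
  integrable_condExp.congr (h.condProb a ha)

variable [IsProbabilityMeasure μ]

lemma IsRDPG.measureReal_adj_eq_inter (h : IsRDPG μ F r X A) {a : Matrix (Fin n) (Fin n) ℝ}
    (ha : IsAdjacency a) {T : Set (Fin n → EuclideanSpace ℝ (Fin d))} (hT : MeasurableSet T) :
    μ.real ({ω | A ω = a} ∩ X ⁻¹' T) = ∫ ω in X ⁻¹' T, edgeLikelihood r (X ω) a ∂μ := by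
  have hcomap := h.measurable_positions.comap_le
  have hTX : MeasurableSet[MeasurableSpace.comap X inferInstance] (X ⁻¹' T) := ⟨T, hT, rfl⟩
  have haA := h.measurableSet_adj_eq a
  calc μ.real ({ω | A ω = a} ∩ X ⁻¹' T)
      = ∫ ω in X ⁻¹' T, {ω | A ω = a}.indicator (fun _ => (1 : ℝ)) ω ∂μ := by
        rw [integral_indicator haA, setIntegral_const, smul_eq_mul, mul_one,
          measureReal_restrict_apply haA]
    _ = ∫ ω in X ⁻¹' T, (μ⟦{ω | A ω = a} | MeasurableSpace.comap X inferInstance⟧) ω ∂μ :=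
        (setIntegral_condExp hcomap ((integrable_const (1 : ℝ)).indicator haA) hTX).symm
    _ = ∫ ω in X ⁻¹' T, edgeLikelihood r (X ω) a ∂μ :=
        setIntegral_congr_ae (hcomap _ hTX) ((h.condProb a ha).mono fun _ hω _ => hω)

lemma IsRDPG.measureReal_mem_le (h : IsRDPG μ F r X A)
    {S : (Fin n → EuclideanSpace ℝ (Fin d)) → Set (Matrix (Fin n) (Fin n) ℝ)}
    (hS : ∀ a, MeasurableSet {x | a ∈ S x}) {ε : ℝ}
    (hε : ∀ᵐ ω ∂μ, bernoulliProb (edgeProb r (X ω)) (bitAdjacency ⁻¹' S (X ω)) ≤ ε) :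
    μ.real {ω | A ω ∈ S (X ω)} ≤ ε := by
  have hTmeas : ∀ g, MeasurableSet (X ⁻¹' {x | bitAdjacency g ∈ S x}) := fun g =>
    h.measurable_positions (hS _)
  have hindicator : ∀ g ω, (X ⁻¹' {x | bitAdjacency g ∈ S x}).indicator
      (fun ω => edgeLikelihood r (X ω) (bitAdjacency g)) ω =
        bernoulliWeight (edgeProb r (X ω)) g * (bitAdjacency ⁻¹' S (X ω)).indicator 1 g :=
    fun g ω => by
      rw [← edgeLikelihood_bitAdjacency]
      by_cases hg : bitAdjacency g ∈ S (X ω) <;> simp [Set.indicator, hg]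
  have hint : ∀ g, Integrable (fun ω =>
      bernoulliWeight (edgeProb r (X ω)) g * (bitAdjacency ⁻¹' S (X ω)).indicator 1 g) μ :=
    fun g => ((h.integrable_edgeLikelihood (isAdjacency_bitAdjacency g)).indicator
      (hTmeas g)).congr (.of_forall (hindicator g))
  calc μ.real {ω | A ω ∈ S (X ω)}
      ≤ μ.real (⋃ g, ({ω | A ω = bitAdjacency g} ∩ X ⁻¹' {x | bitAdjacency g ∈ S x})) := by
        refine measureReal_mono fun ω hω => ?_
        obtain ⟨g, hg⟩ := (h.isAdjacency ω).exists_bitAdjacency_eq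
        exact Set.mem_iUnion.mpr ⟨g, hg.symm, by rwa [Set.mem_preimage, Set.mem_ofPred_eq, hg]⟩
    _ ≤ ∑ g, μ.real ({ω | A ω = bitAdjacency g} ∩ X ⁻¹' {x | bitAdjacency g ∈ S x}) :=
        measureReal_iUnion_fintype_le _
    _ = ∑ g, ∫ ω, bernoulliWeight (edgeProb r (X ω)) g *
          (bitAdjacency ⁻¹' S (X ω)).indicator 1 g ∂μ := by
        refine Finset.sum_congr rfl fun g _ => ?_
        rw [h.measureReal_adj_eq_inter (isAdjacency_bitAdjacency g) (hS _),
          ← integral_indicator (hTmeas g)]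
        exact integral_congr_ae (.of_forall (hindicator g))
    _ = ∫ ω, bernoulliProb (edgeProb r (X ω)) (bitAdjacency ⁻¹' S (X ω)) ∂μ :=
        (integral_finsetSum _ fun g _ => hint g).symm
    _ ≤ ∫ _, ε ∂μ :=
        integral_mono_ae (integrable_finsetSum _ fun g _ => hint g) (integrable_const _) hε
    _ = ε := by simp

end ConditionalProbability

section EventBounds

variable {Ω : Type*} [MeasurableSpace Ω] {μ : Measure Ω}

lemma measureReal_exists_le {κ : Type*} [Fintype κ] {P : κ → Ω → Prop} {ε : ℝ}
    (h : ∀ a, μ.real {ω | P a ω} ≤ ε) : μ.real {ω | ∃ a, P a ω} ≤ Fintype.card κ * ε := by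
  calc μ.real {ω | ∃ a, P a ω} = μ.real (⋃ a, {ω | P a ω}) := by rw [Set.ofPred_exists]
    _ ≤ ∑ a, μ.real {ω | P a ω} := measureReal_iUnion_fintype_le _
    _ ≤ Fintype.card κ * ε := by simpa using Finset.sum_le_sum fun a (_ : a ∈ Finset.univ) => h a

lemma measureReal_mono_of_ae_imp [IsFiniteMeasure μ] {P Q : Ω → Prop}
    (h : ∀ᵐ ω ∂μ, P ω → Q ω) : μ.real {ω | P ω} ≤ μ.real {ω | Q ω} :=
  ENNReal.toReal_mono (measure_ne_top μ _) (measure_mono_ae h)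

end EventBounds

section Hoeffding

variable {ι Ω E : Type*} [Fintype ι] [MeasurableSpace Ω] [MeasurableSpace E] {μ : Measure Ω}
  [IsProbabilityMeasure μ] {F : Measure E} {X : ι → Ω → E}

lemma measureReal_sum_sub_integral_ge_le (hX : ∀ i, Measurable (X i))
    (hlaw : ∀ i, μ.map (X i) = F) (hind : iIndepFun X μ) {f : E → ℝ} (hf : Measurable f)
    (hf1 : ∀ᵐ x ∂F, f x ∈ Set.Icc (-1 : ℝ) 1) {ε : ℝ} (hε : 0 ≤ ε) :
    μ.real {ω | ε ≤ ∑ i, (f (X i ω) - ∫ x, f x ∂F)} ≤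
      Real.exp (-ε ^ 2 / (2 * Fintype.card ι)) := by
  have hmean : ∀ i, ∫ ω, f (X i ω) ∂μ = ∫ x, f x ∂F := fun i => by
    rw [← hlaw i, integral_map (hX i).aemeasurable hf.aestronglyMeasurable]
  have hbound : ∀ i, ∀ᵐ ω ∂μ, f (X i ω) ∈ Set.Icc (-1 : ℝ) 1 := fun i =>
    ae_of_ae_map (hX i).aemeasurable ((hlaw i).symm ▸ hf1)
  have hindep : iIndepFun (fun i ω => f (X i ω) - ∫ x, f x ∂F) μ :=
    hind.comp (fun _ x => f x - ∫ x, f x ∂F) fun _ => hf.sub_const _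
  have hsubgaussian : ∀ i ∈ (Finset.univ : Finset ι),
      HasSubgaussianMGF (fun ω => f (X i ω) - ∫ x, f x ∂F) 1 μ := fun i _ => by
    have := hasSubgaussianMGF_of_mem_Icc (hf.comp (hX i)).aemeasurable (hbound i)
    simp only [Function.comp_apply, hmean] at this
    convert this using 1
    norm_num
  exact (HasSubgaussianMGF.measure_sum_ge_le_of_iIndepFun hindep hsubgaussian hε).trans_eq (by simp)

lemma measureReal_abs_sum_sub_integral_ge_le (hX : ∀ i, Measurable (X i))
    (hlaw : ∀ i, μ.map (X i) = F) (hind : iIndepFun X μ) {f : E → ℝ} (hf : Measurable f)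
    (hf1 : ∀ᵐ x ∂F, f x ∈ Set.Icc (-1 : ℝ) 1) {ε : ℝ} (hε : 0 ≤ ε) :
    μ.real {ω | ε ≤ |∑ i, f (X i ω) - Fintype.card ι * ∫ x, f x ∂F|} ≤
      2 * Real.exp (-ε ^ 2 / (2 * Fintype.card ι)) := by
  have hupper := measureReal_sum_sub_integral_ge_le hX hlaw hind hf hf1 hε
  have hlower := measureReal_sum_sub_integral_ge_le hX hlaw hind hf.neg
    (hf1.mono fun x hx => ⟨neg_le_neg hx.2, neg_le.mpr hx.1⟩) hε
  rw [two_mul]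
  refine (measureReal_mono fun ω hω => ?_).trans
    ((measureReal_union_le _ _).trans (add_le_add hupper hlower))
  simp only [Set.mem_union, Set.mem_ofPred_eq, Pi.neg_apply, integral_neg, Finset.sum_sub_distrib,
    Finset.sum_neg_distrib, Finset.sum_const, Finset.card_univ, nsmul_eq_mul]
  simp only [Set.mem_ofPred_eq, le_abs] at hω
  exact hω.imp id fun h => by linarith

end Hoeffding

section SecondMoment

lemma abs_mul_apply_le_one {d : ℕ} {x : EuclideanSpace ℝ (Fin d)} (hx : ‖x‖ ≤ 1) (j k : Fin d) :
    |x j * x k| ≤ 1 := by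
  rw [abs_mul]
  exact mul_le_one₀ ((PiLp.norm_apply_le x j).trans hx) (abs_nonneg _)
    ((PiLp.norm_apply_le x k).trans hx)

lemma IsRDPG.measureReal_gram_ge_le {n d : ℕ} {Ω : Type*} [MeasurableSpace Ω] {μ : Measure Ω}
    [IsProbabilityMeasure μ] {F : Measure (EuclideanSpace ℝ (Fin d))} {r : ℝ}
    {X : Ω → Fin n → EuclideanSpace ℝ (Fin d)} {A : Ω → Matrix (Fin n) (Fin n) ℝ}
    (h : IsRDPG μ F r X A) (hF : ∀ᵐ x ∂F, ‖x‖ ≤ 1) {ε : ℝ} (hε : 0 ≤ ε) :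
    μ.real {ω | ∃ j k, n * ε ≤ |∑ i, X ω i j * X ω i k - n * secondMoment F j k|} ≤
      d ^ 2 * (2 * Real.exp (-(n * ε ^ 2) / 2)) := by
  have hentry : ∀ j k, μ.real {ω | n * ε ≤ |∑ i, X ω i j * X ω i k - n * secondMoment F j k|} ≤
      2 * Real.exp (-(n * ε ^ 2) / 2) := fun j k => by
    have hbound : ∀ᵐ x ∂F, x j * x k ∈ Set.Icc (-1 : ℝ) 1 := hF.mono fun x hx =>
      abs_le.mp (abs_mul_apply_le_one hx j k)
    have hexponent : -(n * ε) ^ 2 / (2 * n) = -(n * ε ^ 2) / 2 := by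
      rcases Nat.eq_zero_or_pos n with rfl | hn
      · simp
      · field_simp
    have := measureReal_abs_sum_sub_integral_ge_le h.measurable_pos h.law_pos h.indep_pos
      (f := fun x => x j * x k) (by fun_prop) hbound (ε := n * ε) (by positivity)
    rwa [Fintype.card_fin, hexponent] at this
  simpa only [Fintype.card_fin, sq, mul_assoc] using
    measureReal_exists_le fun j => measureReal_exists_le fun k => hentry j k

lemma integral_sum_mul_sq_eq {d : ℕ} {F : Measure (EuclideanSpace ℝ (Fin d))}
    (hint : ∀ j k, Integrable (fun x : EuclideanSpace ℝ (Fin d) => x j * x k) F)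
    (u : Fin d → ℝ) :
    ∫ x, (∑ j, u j * x j) ^ 2 ∂F = u ⬝ᵥ (secondMoment F *ᵥ u) := by
  have hexpand : ∀ x : EuclideanSpace ℝ (Fin d),
      (∑ j, u j * x j) ^ 2 = ∑ j, ∑ k, u j * (x j * x k * u k) := fun x => by
    rw [sq, Finset.sum_mul_sum]
    exact Finset.sum_congr rfl fun j _ => Finset.sum_congr rfl fun k _ => by ring
  have hterm : ∀ j k, Integrable (fun x : EuclideanSpace ℝ (Fin d) => u j * (x j * x k * u k)) F :=
    fun j k => ((hint j k).mul_const _).const_mul _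
  simp only [hexpand]
  rw [integral_finsetSum _ fun j _ => integrable_finsetSum _ fun k _ => hterm j k]
  simp only [dotProduct, Matrix.mulVec, secondMoment, Matrix.of_apply, Finset.mul_sum]
  refine Finset.sum_congr rfl fun j _ => ?_
  rw [integral_finsetSum _ fun k _ => hterm j k]
  exact Finset.sum_congr rfl fun k _ => by rw [integral_const_mul, integral_mul_const]

lemma posSemidef_secondMoment {d : ℕ} {F : Measure (EuclideanSpace ℝ (Fin d))}
    [IsFiniteMeasure F] (hF : ∀ᵐ x ∂F, ‖x‖ ≤ 1) : (secondMoment F).PosSemidef := by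
  have hint : ∀ j k, Integrable (fun x : EuclideanSpace ℝ (Fin d) => x j * x k) F := fun j k =>
    Integrable.of_bound (C := 1) (by fun_prop) (hF.mono fun x hx => abs_mul_apply_le_one hx j k)
  refine Matrix.PosSemidef.of_dotProduct_mulVec_nonneg ?_ fun u => ?_
  · ext j k
    simp only [secondMoment, Matrix.conjTranspose_apply, Matrix.of_apply, star_trivial, mul_comm]
  · rw [star_trivial, ← integral_sum_mul_sq_eq hint]
    exact integral_nonneg fun x => sq_nonneg _

variable {ι κ : Type*} [Fintype ι] [Fintype κ]

lemma exists_pos_mul_dotProduct_self_le {M : Matrix κ κ ℝ} (hM : M.PosSemidef)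
    (hrank : M.rank = Fintype.card κ) :
    ∃ δ : ℝ, 0 < δ ∧ ∀ u : κ → ℝ, δ * (u ⬝ᵥ u) ≤ u ⬝ᵥ (M *ᵥ u) := by
  classical
  rcases isEmpty_or_nonempty κ with hκ | hκ
  · exact ⟨1, one_pos, fun u => by simp [dotProduct]⟩
  have hM_unit : IsUnit M := by
    rw [← Matrix.linearIndependent_rows_iff_isUnit, linearIndependent_iff_card_eq_finrank_span,
      ← hrank, Matrix.rank_eq_finrank_span_row]
    rfl
  obtain ⟨δ, hδ, hle⟩ := (CFC.exists_pos_algebraMap_le_iff hM.isHermitian).mpr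
    fun x hx => (hM_unit.isStrictlyPositive hM.nonneg).spectrum_pos hx
  refine ⟨δ, hδ, fun u => ?_⟩
  have := (Matrix.le_iff.mp hle).dotProduct_mulVec_nonneg u
  rw [Matrix.sub_mulVec, dotProduct_sub, Algebra.algebraMap_eq_smul_one, Matrix.smul_mulVec,
    Matrix.one_mulVec, dotProduct_smul, star_trivial, smul_eq_mul] at this
  linarith

lemma abs_dotProduct_mulVec_le_of_abs_le {E : Matrix κ κ ℝ} {ε : ℝ} (hε : 0 ≤ ε)
    (hE : ∀ j k, |E j k| ≤ ε) (u : κ → ℝ) :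
    |u ⬝ᵥ (E *ᵥ u)| ≤ Fintype.card κ * ε * (u ⬝ᵥ u) := by
  calc |u ⬝ᵥ (E *ᵥ u)| ≤ ∑ j, ∑ k, |u j| * (ε * |u k|) := by
        simp only [dotProduct, Matrix.mulVec, Finset.mul_sum]
        refine (Finset.abs_sum_le_sum_abs _ _).trans (Finset.sum_le_sum fun j _ =>
          (Finset.abs_sum_le_sum_abs _ _).trans (Finset.sum_le_sum fun k _ => ?_))
        rw [abs_mul, abs_mul]
        gcongr
        exact hE j k
    _ = ε * (∑ j, |u j|) ^ 2 := by
        rw [sq, Finset.sum_mul_sum, Finset.mul_sum]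
        refine Finset.sum_congr rfl fun j _ => ?_
        rw [Finset.mul_sum]
        exact Finset.sum_congr rfl fun k _ => by ring
    _ ≤ ε * (Fintype.card κ * (u ⬝ᵥ u)) := by
        gcongr
        simpa [dotProduct, sq_abs, sq] using
          sq_sum_le_card_mul_sum_sq (s := Finset.univ) (f := fun j => |u j|)
    _ = Fintype.card κ * ε * (u ⬝ᵥ u) := by ring

lemma gram_coercive_of_abs_sub_le {M : Matrix κ κ ℝ} {δ ε : ℝ} (hε : 0 ≤ ε)
    (hM : ∀ u : κ → ℝ, 2 * δ * (u ⬝ᵥ u) ≤ u ⬝ᵥ (M *ᵥ u)) (hεδ : Fintype.card κ * ε ≤ δ)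
    {x : Matrix ι κ ℝ} {m : ℝ} (hm : 0 ≤ m)
    (hx : ∀ j k, |∑ i, x i j * x i k - m * M j k| ≤ m * ε) (u : κ → ℝ) :
    m * δ * (u ⬝ᵥ u) ≤ u ⬝ᵥ ((xᵀ * x) *ᵥ u) := by
  have hdev := abs_dotProduct_mulVec_le_of_abs_le (E := xᵀ * x - m • M) (mul_nonneg hm hε)
    (fun j k => by simpa [Matrix.mul_apply] using hx j k) u
  rw [Matrix.sub_mulVec, dotProduct_sub, Matrix.smul_mulVec, dotProduct_smul, smul_eq_mul] at hdev
  have hdev' : m * (Fintype.card κ * ε) * (u ⬝ᵥ u) ≤ m * δ * (u ⬝ᵥ u) := by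
    gcongr
    exact dotProduct_self_nonneg u
  linarith [(abs_le.mp hdev).1, mul_le_mul_of_nonneg_left (hM u) hm]

end SecondMoment

section EmbeddingRows

variable {n d : ℕ} {A : Matrix (Fin n) (Fin n) ℝ} {Xhat : Fin n → EuclideanSpace ℝ (Fin d)}

lemma matrixAbs_apply_self_sq_le (A : Matrix (Fin n) (Fin n) ℝ) (i : Fin n) :
    matrixAbs A i i ^ 2 ≤ (Aᵀ * A) i i := by
  have habs : (matrixAbs A)ᵀ = matrixAbs A :=
    (Matrix.nonneg_iff_posSemidef.mp (CFC.sqrt_nonneg (Aᵀ * A))).isHermitian.eq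
  have hsq : matrixAbs A * matrixAbs A = Aᵀ * A :=
    CFC.sqrt_mul_sqrt_self _ (Matrix.posSemidef_conjTranspose_mul_self A).nonneg
  rw [← hsq, Matrix.mul_apply]
  calc matrixAbs A i i ^ 2 ≤ ∑ j, matrixAbs A i j ^ 2 :=
        Finset.single_le_sum (f := fun j => matrixAbs A i j ^ 2) (fun _ _ => sq_nonneg _)
          (Finset.mem_univ i)
    _ = ∑ j, matrixAbs A i j * matrixAbs A j i := Finset.sum_congr rfl fun j _ => by
        rw [sq, ← Matrix.transpose_apply (matrixAbs A) i j, habs]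

lemma IsASE.norm_sq_le_matrixAbs (h : IsASE A Xhat) (i : Fin n) :
    ‖Xhat i‖ ^ 2 ≤ matrixAbs A i i := by
  obtain ⟨hdn, V, s, hV, -, hA, hXV⟩ := h
  have hV' : Vᵀ * V = 1 := mul_eq_one_comm.mp ((Matrix.mem_orthogonalGroup_iff _ _).mp hV)
  have hs0 : ∀ j, 0 ≤ s j := diagonal_nonneg_of_matrixAbs_eq hV' hA
  calc ‖Xhat i‖ ^ 2 = ∑ j ∈ Finset.univ.map (Fin.castLEEmb hdn), V i j ^ 2 * s j := by
        rw [EuclideanSpace.real_norm_sq_eq, Finset.sum_map]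
        exact Finset.sum_congr rfl fun k _ => by rw [hXV, mul_pow, Real.sq_sqrt (hs0 _)]; rfl
    _ ≤ ∑ j, V i j ^ 2 * s j :=
        Finset.sum_le_univ_sum_of_nonneg fun j => mul_nonneg (sq_nonneg _) (hs0 j)
    _ = matrixAbs A i i := by
        rw [hA, Matrix.mul_apply]
        exact Finset.sum_congr rfl fun j _ => by
          rw [Matrix.mul_diagonal, Matrix.transpose_apply]; ring

lemma IsAdjacency.transpose_mul_self_apply_self (hA : IsAdjacency A) (i : Fin n) :
    (Aᵀ * A) i i = ∑ j, A i j := by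
  rw [Matrix.mul_apply]
  refine Finset.sum_congr rfl fun j _ => ?_
  rw [Matrix.transpose_apply, hA.symm j i]
  rcases hA.zero_or_one i j with h | h <;> rw [h] <;> norm_num

lemma IsASE.norm_pow_four_le_degree (h : IsASE A Xhat) (hA : IsAdjacency A) (i : Fin n) :
    ‖Xhat i‖ ^ 4 ≤ ∑ j, A i j := by
  calc ‖Xhat i‖ ^ 4 = (‖Xhat i‖ ^ 2) ^ 2 := by ring
    _ ≤ matrixAbs A i i ^ 2 := by gcongr; exact h.norm_sq_le_matrixAbs i
    _ ≤ ∑ j, A i j := hA.transpose_mul_self_apply_self i ▸ matrixAbs_apply_self_sq_le A i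

end EmbeddingRows

section ErrorRate

open scoped Matrix.Norms.L2Operator

/-- The constant in the row-wise error bound for an embedding whose Gram matrix is at least
`δ * q ^ 2` and whose noise has size at most `K * q * l`. -/
noncomputable def rowErrorConst (K δ : ℝ) : ℝ :=
  (K + 4 * K ^ 2 / δ) * √(2 / δ) * (2 / δ) + 18 * K ^ 2 * √(2 / δ) / δ + 3 * K * √(2 / δ) / δ
    + 6 * K / δ ^ 2

variable {K δ q l : ℝ}

lemma row_error_le_rowErrorConst (hK : 0 ≤ K) (hδ : 0 < δ) (hq : 0 < q) (hl : 1 ≤ l) :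
    (K * q * l + 4 * (K * q * l) ^ 2 * (q / (δ * q ^ 2))) *
        (q * √(2 / (δ * q ^ 2)) * (2 / (δ * q ^ 2)))
      + 3 * (K * q * l) * (3 * (K * q * l) * √(2 / (δ * q ^ 2))) * (2 / (δ * q ^ 2))
      + q / (δ * q ^ 2) * (3 * (K * q * l) * √(2 / (δ * q ^ 2)))
      + q / (δ * q ^ 2) * (2 * (3 * (K * q * l))) * (q / (δ * q ^ 2))
      ≤ rowErrorConst K δ * l ^ 2 / q := by
  have hsqrt : √(2 / (δ * q ^ 2)) = √(2 / δ) / q := by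
    rw [← div_div, Real.sqrt_div (by positivity), Real.sqrt_sq hq.le]
  have hll : l ≤ l ^ 2 := le_self_pow₀ hl two_ne_zero
  rw [hsqrt]
  set b := √(2 / δ)
  calc _ = (K * l + 4 * K ^ 2 * l ^ 2 / δ) * b * (2 / δ) / q + 18 * K ^ 2 * b / δ * l ^ 2 / q
        + 3 * K * b / δ * l / q + 6 * K / δ ^ 2 * l / q := by
        field_simp
        ring
    _ ≤ (K * l ^ 2 + 4 * K ^ 2 * l ^ 2 / δ) * b * (2 / δ) / q + 18 * K ^ 2 * b / δ * l ^ 2 / q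
        + 3 * K * b / δ * l ^ 2 / q + 6 * K / δ ^ 2 * l ^ 2 / q := by gcongr
    _ = rowErrorConst K δ * l ^ 2 / q := by
        rw [rowErrorConst]
        ring

lemma IsASE.exists_orthogonal_norm_row_sub_le_rowErrorConst {n d : ℕ}
    {A : Matrix (Fin n) (Fin n) ℝ} {X Y : Matrix (Fin n) (Fin d) ℝ} (hA : A.IsHermitian)
    (hX : IsASE A fun i => WithLp.toLp 2 (X i)) (hK : 0 ≤ K) (hδ : 0 < δ) (hq : 0 < q)
    (hl : 1 ≤ l) (hlq : l ^ 2 ≤ q)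
    (hG : ∀ u, δ * q ^ 2 * (u ⬝ᵥ u) ≤ u ⬝ᵥ ((Yᵀ * Y) *ᵥ u)) (hY : ‖Y‖ ≤ q)
    (hYrow : ∀ i, ‖WithLp.toLp 2 (Y i)‖ ≤ 1) (hσ : ‖A - Y * Yᵀ‖ ≤ K * q * l)
    (hτ : ∀ i, ‖WithLp.toLp 2 (((A - Y * Yᵀ) * Y) i)‖ ≤ K * q * l)
    (hKδ : 6 * K ≤ δ * l) (hKδ' : 6 * K < δ ^ 2 * l) :
    ∃ W ∈ Matrix.orthogonalGroup (Fin d) ℝ, ∀ i,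
      ‖WithLp.toLp 2 ((X - Y * W) i)‖ ≤ rowErrorConst K δ * l ^ 2 / q := by
  have hgap : 6 * (K * q * l) ≤ δ * q ^ 2 := by
    calc 6 * (K * q * l) = (6 * K) * (q * l) := by ring
      _ ≤ δ * l * (q * l) := by gcongr
      _ = δ * q * l ^ 2 := by ring
      _ ≤ δ * q * q := by gcongr
      _ = δ * q ^ 2 := by ring
  have hsmall : q / (δ * q ^ 2) * (2 * (3 * (K * q * l))) * (q / (δ * q ^ 2)) < 1 := by
    calc q / (δ * q ^ 2) * (2 * (3 * (K * q * l))) * (q / (δ * q ^ 2))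
        = 6 * K * l / (δ ^ 2 * q) := by
          field_simp
          ring
      _ < δ ^ 2 * l * l / (δ ^ 2 * q) := by gcongr
      _ = δ ^ 2 * l ^ 2 / (δ ^ 2 * q) := by ring
      _ ≤ 1 := (div_le_one (by positivity)).mpr (by gcongr)
  obtain ⟨W, hW, hWrow⟩ := hX.exists_orthogonal_norm_row_sub_le hA (by positivity) hG hY hYrow hσ
    hgap hτ hsmall
  exact ⟨W, hW, fun i => (hWrow i).trans (row_error_le_rowErrorConst hK hδ hq hl)⟩

end ErrorRate

section ScaledPositions

open scoped Matrix.Norms.L2Operator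

variable {ι κ : Type*} {r : ℝ} {x : ι → EuclideanSpace ℝ κ}

/-- The matrix with rows `r^{1/2} x i`, which the spectral embedding estimates up to an orthogonal
transformation. -/
noncomputable def scaledPositions (r : ℝ) (x : ι → EuclideanSpace ℝ κ) : Matrix ι κ ℝ :=
  Matrix.of fun i k => √r * x i k

lemma toLp_scaledPositions_row (r : ℝ) (x : ι → EuclideanSpace ℝ κ) (i : ι) :
    WithLp.toLp 2 (scaledPositions r x i) = √r • x i :=
  rfl

variable [Fintype κ]

lemma norm_le_sqrt_card_mul_of_abs_le (v : EuclideanSpace ℝ κ) {M : ℝ} (hM : 0 ≤ M)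
    (hv : ∀ k, |v k| ≤ M) : ‖v‖ ≤ √(Fintype.card κ) * M := by
  refine le_of_sq_le_sq ?_ (by positivity)
  rw [EuclideanSpace.real_norm_sq_eq, mul_pow, Real.sq_sqrt (by positivity)]
  calc ∑ k, v k ^ 2 ≤ ∑ _k : κ, M ^ 2 :=
        Finset.sum_le_sum fun k _ => sq_le_sq.mpr ((hv k).trans (le_abs_self M))
    _ = Fintype.card κ * M ^ 2 := by simp

lemma l2_opNorm_le_sqrt_card_mul_of_row_le [Fintype ι] [DecidableEq κ] (Y : Matrix ι κ ℝ) {b : ℝ}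
    (hb : 0 ≤ b) (hY : ∀ i, ‖WithLp.toLp 2 (Y i)‖ ≤ b) : ‖Y‖ ≤ √(Fintype.card ι) * b := by
  refine l2_opNorm_le_of_norm_mulVec_le (by positivity) fun v => ?_
  rw [mul_assoc]
  refine norm_le_sqrt_card_mul_of_abs_le _ (by positivity) fun i => ?_
  refine (abs_dotProduct_le_norm_mul_norm (Y i) v).trans ?_
  gcongr
  exact hY i

lemma norm_scaledPositions_row_le (r : ℝ) {i : ι} (hx : ‖x i‖ ≤ 1) :
    ‖WithLp.toLp 2 (scaledPositions r x i)‖ ≤ √r := by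
  rw [toLp_scaledPositions_row, norm_smul, Real.norm_of_nonneg (Real.sqrt_nonneg r)]
  exact mul_le_of_le_one_right (Real.sqrt_nonneg r) hx

lemma scaledPositions_mul_transpose_apply (hr : 0 ≤ r) (x : ι → EuclideanSpace ℝ κ) (i j : ι) :
    (scaledPositions r x * (scaledPositions r x)ᵀ) i j = r * inner ℝ (x i) (x j) := by
  rw [PiLp.inner_apply, Matrix.mul_apply, Finset.mul_sum]
  refine Finset.sum_congr rfl fun k _ => ?_
  simp only [scaledPositions, Matrix.transpose_apply, Matrix.of_apply, RCLike.inner_apply,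
    conj_trivial]
  linear_combination x i k * x j k * Real.mul_self_sqrt hr

lemma scaledPositions_gram_coercive [Fintype ι] (hr : 0 ≤ r) {M : Matrix κ κ ℝ} {δ ε : ℝ}
    (hε : 0 ≤ ε) (hM : ∀ u : κ → ℝ, 2 * δ * (u ⬝ᵥ u) ≤ u ⬝ᵥ (M *ᵥ u)) (hεδ : Fintype.card κ * ε ≤ δ)
    (hx : ∀ j k, |∑ i, x i j * x i k - Fintype.card ι * M j k| ≤ Fintype.card ι * ε)
    (u : κ → ℝ) :
    δ * (Fintype.card ι * r) * (u ⬝ᵥ u) ≤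
      u ⬝ᵥ (((scaledPositions r x)ᵀ * scaledPositions r x) *ᵥ u) := by
  rw [mul_comm δ]
  refine gram_coercive_of_abs_sub_le hε hM hεδ (by positivity) (fun j k => ?_) u
  have hsum : ∑ i, scaledPositions r x i j * scaledPositions r x i k = r * ∑ i, x i j * x i k := by
    rw [Finset.mul_sum]
    refine Finset.sum_congr rfl fun i _ => ?_
    simp only [scaledPositions, Matrix.of_apply]
    linear_combination x i j * x i k * Real.mul_self_sqrt hr
  calc |∑ i, scaledPositions r x i j * scaledPositions r x i k - Fintype.card ι * r * M j k|
      = r * |∑ i, x i j * x i k - Fintype.card ι * M j k| := by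
        rw [hsum, ← abs_of_nonneg hr, ← abs_mul, abs_of_nonneg hr]
        ring_nf
    _ ≤ r * (Fintype.card ι * ε) := by gcongr; exact hx j k
    _ = Fintype.card ι * r * ε := by ring

lemma toLp_sub_scaledPositions_mul_row [DecidableEq κ] (r : ℝ) (x : ι → EuclideanSpace ℝ κ)
    (X : Matrix ι κ ℝ) (W : Matrix κ κ ℝ) (i : ι) :
    WithLp.toLp 2 ((X - scaledPositions r x * W) i) =
      WithLp.toLp 2 (X i) - √r • Matrix.toEuclideanLin Wᵀ (x i) := by
  ext k
  simp only [PiLp.sub_apply, PiLp.smul_apply, Matrix.sub_apply, smul_eq_mul, Matrix.ofLp_toLpLin,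
    Matrix.toLin'_apply, Matrix.mulVec, dotProduct, Matrix.mul_apply, scaledPositions,
    Matrix.of_apply, Matrix.transpose_apply, Finset.mul_sum]
  congr 1
  exact Finset.sum_congr rfl fun j _ => by ring

variable [DecidableEq ι] {a : Matrix ι ι ℝ}

lemma sub_scaledPositions_mul_transpose (hr : 0 ≤ r) (ha : ∀ i, a i i = 0)
    (x : ι → EuclideanSpace ℝ κ) :
    a - scaledPositions r x * (scaledPositions r x)ᵀ =
      centeredAdjacency r x a - Matrix.diagonal fun i => r * ‖x i‖ ^ 2 := by
  ext i j
  rw [centeredAdjacency, Matrix.sub_apply, Matrix.sub_apply, Matrix.sub_apply,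
    scaledPositions_mul_transpose_apply hr]
  rcases eq_or_ne i j with rfl | hij
  · rw [Matrix.diagonal_apply_eq, real_inner_self_eq_norm_sq, hollowMatrix_apply_self, ha, sub_zero]
  · rw [Matrix.diagonal_apply_ne _ hij, sub_zero, hollowMatrix_apply_of_ne _ hij, edgeProb_mk]

lemma norm_sub_scaledPositions_mul_transpose_le [Fintype ι] (hr0 : 0 ≤ r) (hr1 : r ≤ 1)
    (ha : ∀ i, a i i = 0) (hx : ∀ i, ‖x i‖ ≤ 1) :
    ‖a - scaledPositions r x * (scaledPositions r x)ᵀ‖ ≤ ‖centeredAdjacency r x a‖ + 1 := by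
  rw [sub_scaledPositions_mul_transpose hr0 ha]
  refine (norm_sub_le _ _).trans (add_le_add_right ?_ _)
  rw [Matrix.l2_opNorm_diagonal]
  refine (pi_norm_le_iff_of_nonneg zero_le_one).mpr fun i => ?_
  rw [Real.norm_of_nonneg (by positivity)]
  exact mul_le_one₀ hr1 (by positivity) (pow_le_one₀ (norm_nonneg _) (hx i))

lemma norm_row_sub_scaledPositions_mul_le [Fintype ι] (hr0 : 0 ≤ r) (hr1 : r ≤ 1)
    (ha : ∀ i, a i i = 0) (hx : ∀ i, ‖x i‖ ≤ 1) {M : ℝ} (hM : 0 ≤ M) {i : ι}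
    (hrow : ∀ k, |(centeredAdjacency r x a *ᵥ fun j => x j k) i| ≤ M) :
    ‖WithLp.toLp 2 (((a - scaledPositions r x * (scaledPositions r x)ᵀ) *
      scaledPositions r x) i)‖ ≤ √(Fintype.card κ) * (√r * M) + 1 := by
  set Y := scaledPositions r x with hY
  have hsplit : WithLp.toLp 2 (((a - Y * Yᵀ) * Y) i) =
      WithLp.toLp 2 ((centeredAdjacency r x a * Y) i) -
        (r * ‖x i‖ ^ 2) • WithLp.toLp 2 (Y i) := by
    rw [sub_scaledPositions_mul_transpose hr0 ha, Matrix.sub_mul]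
    ext k
    simp [Matrix.diagonal_mul]
  have hcentered : ‖WithLp.toLp 2 ((centeredAdjacency r x a * Y) i)‖ ≤
      √(Fintype.card κ) * (√r * M) := by
    refine norm_le_sqrt_card_mul_of_abs_le _ (by positivity) fun k => ?_
    have hentry : (centeredAdjacency r x a * Y) i k =
        √r * (centeredAdjacency r x a *ᵥ fun j => x j k) i := by
      simp only [Matrix.mul_apply, Matrix.mulVec, dotProduct, Finset.mul_sum, hY, scaledPositions,
        Matrix.of_apply]
      exact Finset.sum_congr rfl fun j _ => by ring
    change |(centeredAdjacency r x a * Y) i k| ≤ _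
    rw [hentry, abs_mul, abs_of_nonneg (Real.sqrt_nonneg r)]
    gcongr
    exact hrow k
  have hdiagonal : ‖(r * ‖x i‖ ^ 2) • WithLp.toLp 2 (Y i)‖ ≤ 1 := by
    rw [norm_smul, Real.norm_of_nonneg (by positivity)]
    exact mul_le_one₀ (mul_le_one₀ hr1 (by positivity) (pow_le_one₀ (norm_nonneg _) (hx i)))
      (norm_nonneg _) ((norm_scaledPositions_row_le r (hx i)).trans (Real.sqrt_le_one.mpr hr1))
  rw [hsplit]
  exact (norm_sub_le _ _).trans (add_le_add hcentered hdiagonal)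

end ScaledPositions

section DeterministicBounds

open scoped Matrix.Norms.L2Operator

variable {n d : ℕ} {r : ℝ} {x : Fin n → EuclideanSpace ℝ (Fin d)} {a : Matrix (Fin n) (Fin n) ℝ}

lemma embeddingErrorBound_of_spectral (hd : 1 ≤ d) (hr0 : 0 ≤ r) (hr1 : r ≤ 1)
    (ha : IsAdjacency a) (hx : ∀ i, ‖x i‖ ≤ 1) {δ K l q : ℝ} (hK : 0 ≤ K) (hδ : 0 < δ)
    (hl : 1 ≤ l) (hlog : l ^ 2 = Real.log n) (hq : q = √(n * r)) (hlq : l ^ 2 ≤ q)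
    (hG : ∀ u, δ * (n * r) * (u ⬝ᵥ u) ≤
      u ⬝ᵥ (((scaledPositions r x)ᵀ * scaledPositions r x) *ᵥ u))
    (hnorm : ‖centeredAdjacency r x a‖ ≤ K * q * l)
    (hrow : ∀ i k, |(centeredAdjacency r x a *ᵥ fun j => x j k) i| ≤ K * √n * l)
    (hKδ : 6 * (√d * K + 1) ≤ δ * l) (hKδ' : 6 * (√d * K + 1) < δ ^ 2 * l)
    (hC : rowErrorConst (√d * K + 1) δ ≤ l ^ 2) : EmbeddingErrorBound 1 r x a := by
  intro Xhat hXhat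
  have hsd : 1 ≤ √(d : ℝ) := Real.one_le_sqrt.mpr (by exact_mod_cast hd)
  have hq1 : 1 ≤ q := (one_le_pow₀ hl).trans hlq
  have hq0 : 0 < q := one_pos.trans_le hq1
  have hql : 1 ≤ q * l := one_le_mul_of_one_le_of_one_le hq1 hl
  have hq_sq : q ^ 2 = n * r := by rw [hq, Real.sq_sqrt (by positivity)]
  have hq_mul : q = √n * √r := by rw [hq, Real.sqrt_mul n.cast_nonneg]
  have hA : a.IsHermitian := Matrix.IsHermitian.ext fun i j => ha.symm j i
  have habsorb : √d * (K * q * l) + 1 ≤ (√d * K + 1) * q * l := by linarith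
  have hYrow : ∀ i, ‖WithLp.toLp 2 (scaledPositions r x i)‖ ≤ √r := fun i =>
    norm_scaledPositions_row_le r (hx i)
  have hY : ‖scaledPositions r x‖ ≤ q := by
    rw [hq_mul]
    simpa using
      l2_opNorm_le_sqrt_card_mul_of_row_le (scaledPositions r x) (Real.sqrt_nonneg r) hYrow
  have hσ : ‖a - scaledPositions r x * (scaledPositions r x)ᵀ‖ ≤ (√d * K + 1) * q * l := by
    refine (norm_sub_scaledPositions_mul_transpose_le hr0 hr1 ha.hollow hx).trans ?_
    refine le_trans (add_le_add_left (hnorm.trans ?_) 1) habsorb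
    exact le_mul_of_one_le_left (by positivity) hsd
  have hτ : ∀ i, ‖WithLp.toLp 2 (((a - scaledPositions r x * (scaledPositions r x)ᵀ) *
      scaledPositions r x) i)‖ ≤ (√d * K + 1) * q * l := fun i => by
    refine (norm_row_sub_scaledPositions_mul_le hr0 hr1 ha.hollow hx (by positivity)
      (hrow i)).trans (le_trans (le_of_eq ?_) habsorb)
    rw [Fintype.card_fin, hq_mul]
    ring
  obtain ⟨W, hW, hWrow⟩ := IsASE.exists_orthogonal_norm_row_sub_le_rowErrorConst
    (X := Matrix.of fun i => Xhat i) (Y := scaledPositions r x) (K := √d * K + 1) hA hXhat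
    (by positivity) hδ hq0 hl hlq (by rwa [hq_sq]) hY
    (fun i => (hYrow i).trans (Real.sqrt_le_one.mpr hr1)) hσ hτ hKδ hKδ'
  refine ⟨Wᵀ, Unitary.star_mem hW, fun i => ?_⟩
  have hi := hWrow i
  rw [toLp_sub_scaledPositions_mul_row] at hi
  refine hi.trans ?_
  rw [← hq, ← hlog]
  refine div_le_div_of_nonneg_right ?_ hq0.le
  calc rowErrorConst (√d * K + 1) δ * l ^ 2 ≤ l ^ 2 * l ^ 2 := by gcongr
    _ = 1 * 1 * (l ^ 2) ^ 2 := by ring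
    _ ≤ 1 * √d * (l ^ 2) ^ 2 := by gcongr

lemma embeddingErrorBound_of_degree_le (hd : 1 ≤ d) (hr0 : 0 < r) (hr1 : r ≤ 1) (hn : 0 < n)
    (ha : IsAdjacency a) (hx : ∀ i, ‖x i‖ ≤ 1) (hlog : 1 ≤ Real.log n)
    (hsparse : n * r ≤ Real.log n ^ 2) (hdeg : ∀ i, ∑ j, a i j ≤ (Real.log n - 1) ^ 4) :
    EmbeddingErrorBound 1 r x a := by
  intro Xhat hXhat
  refine ⟨1, Submonoid.one_mem _, fun i => ?_⟩
  have hsd : 1 ≤ √(d : ℝ) := Real.one_le_sqrt.mpr (by exact_mod_cast hd)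
  have hXhat_norm : ‖Xhat i‖ ≤ Real.log n - 1 :=
    le_of_pow_le_pow_left₀ four_ne_zero (by linarith)
      ((hXhat.norm_pow_four_le_degree ha i).trans (hdeg i))
  have hx_norm : ‖√r • Matrix.toEuclideanLin (1 : Matrix (Fin d) (Fin d) ℝ) (x i)‖ ≤ 1 := by
    rw [norm_smul, Real.norm_of_nonneg (Real.sqrt_nonneg r)]
    exact mul_le_one₀ (Real.sqrt_le_one.mpr hr1) (norm_nonneg _) (by simpa using hx i)
  have hsqrt : √(n * r) ≤ Real.log n := Real.sqrt_le_iff.mpr ⟨by linarith, hsparse⟩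
  rw [le_div_iff₀ (Real.sqrt_pos.mpr (by positivity))]
  calc _ ≤ Real.log n * Real.log n := by
        gcongr
        exact (norm_sub_le _ _).trans (by linarith)
    _ = 1 * 1 * Real.log n ^ 2 := by ring
    _ ≤ 1 * √d * Real.log n ^ 2 := by gcongr

end DeterministicBounds

section EdgeProbabilities

variable {V E : Type*} [NormedAddCommGroup E] [InnerProductSpace ℝ E] {r : ℝ} {x : V → E}

lemma edgeProb_mem_Icc (hr : 0 ≤ r) (hx : ∀ i j, inner ℝ (x i) (x j) ∈ Set.Icc (0 : ℝ) 1)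
    (e : Edge V) : edgeProb r x e ∈ Set.Icc 0 r := by
  revert e
  refine Edge.forall_iff.mpr fun i j h => ?_
  rw [edgeProb_mk]
  exact ⟨mul_nonneg hr (hx i j).1, mul_le_of_le_one_right hr (hx i j).2⟩

lemma norm_le_one_of_inner_self_le_one {v : E} (hv : inner ℝ v v ≤ 1) : ‖v‖ ≤ 1 := by
  rwa [real_inner_self_eq_norm_sq, sq_le_one_iff₀ (norm_nonneg _)] at hv

variable [DecidableEq V]

lemma continuous_centeredAdjacency_apply (r : ℝ) (a : Matrix V V ℝ) (i j : V) :
    Continuous fun x : V → E => centeredAdjacency r x a i j := by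
  simp only [centeredAdjacency, Matrix.sub_apply]
  refine continuous_const.sub ?_
  rcases eq_or_ne i j with rfl | h
  · simp only [hollowMatrix_apply_self]
    exact continuous_const
  · simp only [hollowMatrix_apply_of_ne _ h, edgeProb_mk]
    fun_prop

lemma sum_row_le_add_centeredAdjacency_mulVec_one [Fintype V] (hr : 0 ≤ r)
    (hx : ∀ i j, inner ℝ (x i) (x j) ∈ Set.Icc (0 : ℝ) 1) (a : Matrix V V ℝ) (i : V) :
    ∑ j, a i j ≤ Fintype.card V * r + (centeredAdjacency r x a *ᵥ 1) i := by
  have hmean : ∀ j, hollowMatrix (edgeProb r x) i j ≤ r := fun j => by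
    rcases eq_or_ne i j with rfl | h
    · rwa [hollowMatrix_apply_self]
    · rw [hollowMatrix_apply_of_ne _ h]
      exact (edgeProb_mem_Icc hr hx _).2
  have hsum : ∑ j, hollowMatrix (edgeProb r x) i j ≤ Fintype.card V * r := by
    simpa using Finset.sum_le_sum fun j (_ : j ∈ Finset.univ) => hmean j
  have hsub : (centeredAdjacency r x a *ᵥ 1) i =
      ∑ j, a i j - ∑ j, hollowMatrix (edgeProb r x) i j := by
    simp [centeredAdjacency, Matrix.mulVec, dotProduct]
  linarith

end EdgeProbabilities

section BadEvents

variable {n d : ℕ} {r : ℝ} {Ω : Type*} [MeasurableSpace Ω] {μ : Measure Ω}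
  [IsProbabilityMeasure μ] {F : Measure (EuclideanSpace ℝ (Fin d))}
  {X : Ω → Fin n → EuclideanSpace ℝ (Fin d)} {A : Ω → Matrix (Fin n) (Fin n) ℝ}

lemma IsRDPG.measureReal_trace_ge_le (h : IsRDPG μ F r X A) (hr0 : 0 < r) (hr1 : r ≤ 1)
    (hX : ∀ᵐ ω ∂μ, ∀ i j, inner ℝ (X ω i) (X ω j) ∈ Set.Icc (0 : ℝ) 1) {k : ℕ} (hk : 0 < k)
    (hkn : 2 * k ≤ n * r) {s : ℝ} (hs : 0 < s) :
    μ.real {ω | s ≤ (centeredAdjacency r (X ω) (A ω) ^ (2 * k)).trace} ≤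
      n * (8 * k * (n * r)) ^ k / s := by
  refine h.measureReal_mem_le (S := fun x => {a | s ≤ (centeredAdjacency r x a ^ (2 * k)).trace})
    (fun a => ?_) ?_
  · have hcont : Continuous fun x : Fin n → EuclideanSpace ℝ (Fin d) => centeredAdjacency r x a :=
      continuous_matrix (continuous_centeredAdjacency_apply r a)
    exact measurableSet_le measurable_const (hcont.pow _).matrix_trace.measurable
  · filter_upwards [hX] with ω hω
    have hp : ∀ e, edgeProb r (X ω) e ∈ Set.Icc (0 : ℝ) 1 := fun e =>
      Set.Icc_subset_Icc_right hr1 (edgeProb_mem_Icc hr0.le hω e)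
    have hexpect := bernoulliExpect_trace_pow_le hp hr0 hr1
      (fun e => (edgeProb_mem_Icc hr0.le hω e).2) hk (by rwa [Fintype.card_fin])
    rw [Fintype.card_fin] at hexpect
    simp only [Set.preimage_ofPred_eq, centeredAdjacency_bitAdjacency]
    refine (bernoulliProb_le_expect_div hp (fun g => ?_) hs).trans (by gcongr)
    exact trace_pow_nonneg (Matrix.IsHermitian.ext fun i j => hollowMatrix_apply_comm _ j i)
      (even_two_mul k)

lemma IsRDPG.measureReal_mulVec_ge_le (h : IsRDPG μ F r X A) (hr0 : 0 ≤ r) (hr1 : r ≤ 1)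
    (hX : ∀ᵐ ω ∂μ, ∀ i j, inner ℝ (X ω i) (X ω j) ∈ Set.Icc (0 : ℝ) 1)
    {v : (Fin n → EuclideanSpace ℝ (Fin d)) → Fin n → ℝ} (hv : Measurable v)
    (hv1 : ∀ᵐ ω ∂μ, ∀ j, |v (X ω) j| ≤ 1) {t : ℝ} (ht0 : 0 ≤ t) (ht1 : t ≤ 1) (s : ℝ) (i : Fin n) :
    μ.real {ω | s ≤ (centeredAdjacency r (X ω) (A ω) *ᵥ v (X ω)) i} ≤
      Real.exp (t ^ 2 * (n * r) - t * s) := by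
  refine h.measureReal_mem_le (S := fun x => {a | s ≤ (centeredAdjacency r x a *ᵥ v x) i})
    (fun a => ?_) ?_
  · have hform : Measurable fun x => (centeredAdjacency r x a *ᵥ v x) i := by
      simp only [Matrix.mulVec, dotProduct]
      exact Finset.measurable_fun_sum _ fun j _ =>
        (continuous_centeredAdjacency_apply r a i j).measurable.mul (measurable_pi_iff.mp hv j)
    exact measurableSet_le measurable_const hform
  · filter_upwards [hX, hv1] with ω hω hvω
    have hp : ∀ e, edgeProb r (X ω) e ∈ Set.Icc (0 : ℝ) 1 := fun e =>
      Set.Icc_subset_Icc_right hr1 (edgeProb_mem_Icc hr0 hω e)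
    simp only [Set.preimage_ofPred_eq, centeredAdjacency_bitAdjacency]
    have := bernoulliProb_hollowMatrix_mulVec_ge_le hp hr0
      (fun e => (edgeProb_mem_Icc hr0 hω e).2) i hvω ht0 ht1 s
    rwa [Fintype.card_fin, mul_comm r] at this

lemma IsRDPG.measureReal_abs_mulVec_coord_ge_le (h : IsRDPG μ F r X A) (hr0 : 0 ≤ r) (hr1 : r ≤ 1)
    (hX : ∀ᵐ ω ∂μ, ∀ i j, inner ℝ (X ω i) (X ω j) ∈ Set.Icc (0 : ℝ) 1) {t : ℝ} (ht0 : 0 ≤ t)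
    (ht1 : t ≤ 1) (s : ℝ) :
    μ.real {ω | ∃ i k, s ≤ |(centeredAdjacency r (X ω) (A ω) *ᵥ fun j => X ω j k) i|} ≤
      n * (d * (2 * Real.exp (t ^ 2 * (n * r) - t * s))) := by
  have hcoord : ∀ k, ∀ᵐ ω ∂μ, ∀ j, |X ω j k| ≤ 1 := fun k => hX.mono fun ω hω j =>
    (PiLp.norm_apply_le (X ω j) k).trans (norm_le_one_of_inner_self_le_one (hω j j).2)
  have hentry : ∀ i k, μ.real {ω | s ≤ |(centeredAdjacency r (X ω) (A ω) *ᵥ fun j => X ω j k) i|} ≤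
      2 * Real.exp (t ^ 2 * (n * r) - t * s) := fun i k => by
    have hupper := h.measureReal_mulVec_ge_le hr0 hr1 hX (v := fun x j => x j k) (by fun_prop)
      (hcoord k) ht0 ht1 s i
    have hlower := h.measureReal_mulVec_ge_le hr0 hr1 hX (v := -fun x j => x j k) (by fun_prop)
      (by simpa only [Pi.neg_apply, abs_neg] using hcoord k) ht0 ht1 s i
    rw [two_mul]
    refine (measureReal_mono fun ω hω => ?_).trans
      ((measureReal_union_le _ _).trans (add_le_add hupper hlower))
    simpa only [Set.mem_union, Set.mem_ofPred_eq, Pi.neg_apply, Matrix.mulVec_neg, le_abs] using hω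
  simpa only [Fintype.card_fin] using
    measureReal_exists_le fun i => measureReal_exists_le fun k => hentry i k

lemma IsRDPG.measureReal_degree_ge_le (h : IsRDPG μ F r X A) (hr0 : 0 ≤ r) (hr1 : r ≤ 1)
    (hX : ∀ᵐ ω ∂μ, ∀ i j, inner ℝ (X ω i) (X ω j) ∈ Set.Icc (0 : ℝ) 1) (s : ℝ) :
    μ.real {ω | ∃ i, s ≤ ∑ j, A ω i j} ≤ n * Real.exp (2 * (n * r) - s) := by
  have hentry : ∀ i, μ.real {ω | s ≤ ∑ j, A ω i j} ≤ Real.exp (2 * (n * r) - s) := fun i => by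
    have hform := h.measureReal_mulVec_ge_le hr0 hr1 hX (v := fun _ => 1) measurable_const
      (by simp) zero_le_one le_rfl (s - n * r) i
    rw [show (1 : ℝ) ^ 2 * (n * r) - 1 * (s - n * r) = 2 * (n * r) - s by ring] at hform
    refine (measureReal_mono_of_ae_imp ?_).trans hform
    filter_upwards [hX] with ω hω (hs : s ≤ ∑ j, A ω i j)
    have hdegree := sum_row_le_add_centeredAdjacency_mulVec_one hr0 hω (A ω) i
    rw [Fintype.card_fin] at hdegree
    exact sub_le_iff_le_add'.mpr (hs.trans hdegree)
  simpa only [Fintype.card_fin] using measureReal_exists_le hentry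

end BadEvents

section NoiseBounds

lemma exists_two_pow_mem_Icc {L : ℝ} (hL : 1 ≤ L) : ∃ j : ℕ, (2 : ℝ) ^ j ∈ Set.Icc L (2 * L) := by
  obtain ⟨j, hj, hj'⟩ := exists_nat_pow_near hL one_lt_two
  exact ⟨j + 1, hj'.le, by rw [pow_succ]; linarith⟩

open scoped Matrix.Norms.L2Operator in
lemma l2_opNorm_le_of_trace_pow_le {V : Type*} [Fintype V] [DecidableEq V] {H : Matrix V V ℝ}
    (hH : H.IsHermitian) {a m L : ℝ} (ha : 0 ≤ a) (hm : 0 ≤ m) (hL : 0 ≤ L) {j : ℕ}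
    (hj : (2 : ℝ) ^ j ∈ Set.Icc L (2 * L))
    (htrace : (H ^ (2 * 2 ^ j)).trace ≤ Real.exp (a * L) * (8 * 2 ^ j * m) ^ 2 ^ j) :
    ‖H‖ ≤ 4 * Real.exp (a / 2) * √m * √L := by
  have hsq : (4 * Real.exp (a / 2) * √m * √L) ^ 2 = Real.exp a * (8 * (2 * L) * m) := by
    have hexp : Real.exp (a / 2) ^ 2 = Real.exp a := by
      rw [← Real.exp_nat_mul]
      ring_nf
    rw [mul_pow, mul_pow, mul_pow, Real.sq_sqrt hm, Real.sq_sqrt hL, hexp]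
    ring
  refine le_of_pow_le_pow_left₀ (n := 2 * 2 ^ j) (by positivity) (by positivity) ?_
  calc ‖H‖ ^ (2 * 2 ^ j) ≤ (H ^ (2 * 2 ^ j)).trace := l2_opNorm_pow_le_trace hH j
    _ ≤ Real.exp (a * L) * (8 * 2 ^ j * m) ^ 2 ^ j := htrace
    _ ≤ Real.exp (a * 2 ^ j) * (8 * (2 * L) * m) ^ 2 ^ j := by gcongr <;> [exact hj.1; exact hj.2]
    _ = (Real.exp a * (8 * (2 * L) * m)) ^ 2 ^ j := by
        rw [mul_pow (Real.exp a), ← Real.exp_nat_mul]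
        push_cast
        rw [mul_comm a]
    _ = (4 * Real.exp (a / 2) * √m * √L) ^ (2 * 2 ^ j) := by rw [pow_mul, hsq]

variable {n d : ℕ} {r c K : ℝ} {Ω : Type*} [MeasurableSpace Ω] {μ : Measure Ω}
  [IsProbabilityMeasure μ] {F : Measure (EuclideanSpace ℝ (Fin d))}
  {X : Ω → Fin n → EuclideanSpace ℝ (Fin d)} {A : Ω → Matrix (Fin n) (Fin n) ℝ}

lemma IsAdjacency.isHermitian_centeredAdjacency {E : Type*} [NormedAddCommGroup E]
    [InnerProductSpace ℝ E] {a : Matrix (Fin n) (Fin n) ℝ} (ha : IsAdjacency a) (r : ℝ)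
    (x : Fin n → E) : (centeredAdjacency r x a).IsHermitian :=
  Matrix.IsHermitian.sub (Matrix.IsHermitian.ext fun i j => ha.symm j i)
    (Matrix.IsHermitian.ext fun i j => hollowMatrix_apply_comm _ j i)

lemma natCast_rpow_eq_exp_mul_log (hn : 0 < n) (a : ℝ) :
    (n : ℝ) ^ a = Real.exp (a * Real.log n) := by
  rw [Real.rpow_def_of_pos (by exact_mod_cast hn), mul_comm]

open scoped Matrix.Norms.L2Operator in
lemma IsRDPG.measureReal_norm_centeredAdjacency_gt_le (h : IsRDPG μ F r X A) (hr0 : 0 < r)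
    (hr1 : r ≤ 1) (hX : ∀ᵐ ω ∂μ, ∀ i j, inner ℝ (X ω i) (X ω j) ∈ Set.Icc (0 : ℝ) 1)
    (hn : 0 < n) (hL : 4 ≤ Real.log n) (hdense : Real.log n ^ 2 ≤ n * r) (hc : 0 ≤ c + 2)
    (hK : 4 * Real.exp ((c + 2) / 2) ≤ K) :
    μ.real {ω | K * √(n * r) * √(Real.log n) < ‖centeredAdjacency r (X ω) (A ω)‖} ≤
      (n : ℝ) ^ (-(c + 1)) := by
  obtain ⟨j, hj⟩ := exists_two_pow_mem_Icc (L := Real.log n) (by linarith)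
  have hn' : (0 : ℝ) < n := by exact_mod_cast hn
  have hm : 0 < n * r := by positivity
  have hjm : 2 * ((2 ^ j : ℕ) : ℝ) ≤ n * r := by
    push_cast
    nlinarith [hj.2]
  set T := Real.exp ((c + 2) * Real.log n) * (8 * 2 ^ j * (n * r)) ^ 2 ^ j with hT
  calc μ.real {ω | K * √(n * r) * √(Real.log n) < ‖centeredAdjacency r (X ω) (A ω)‖}
      ≤ μ.real {ω | T ≤ (centeredAdjacency r (X ω) (A ω) ^ (2 * 2 ^ j)).trace} := by
        refine measureReal_mono_of_ae_imp (.of_forall fun ω => ?_)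
        contrapose!
        intro hω
        refine (l2_opNorm_le_of_trace_pow_le ((h.isAdjacency ω).isHermitian_centeredAdjacency r _)
          hc hm.le (by linarith) hj hω.le).trans (by gcongr)
    _ ≤ n * (8 * (2 ^ j : ℕ) * (n * r)) ^ 2 ^ j / T :=
        h.measureReal_trace_ge_le hr0 hr1 hX (by positivity) hjm (by positivity)
    _ = n / (n : ℝ) ^ (c + 2) := by
        push_cast
        rw [hT, mul_div_mul_right _ _ (by positivity), natCast_rpow_eq_exp_mul_log hn]
    _ = (n : ℝ) ^ (-(c + 1)) := by
        nth_rw 1 [← Real.rpow_one (n : ℝ)]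
        rw [← Real.rpow_sub hn']
        ring_nf

lemma IsRDPG.measureReal_abs_mulVec_coord_gt_le (h : IsRDPG μ F r X A) (hr0 : 0 ≤ r)
    (hr1 : r ≤ 1) (hX : ∀ᵐ ω ∂μ, ∀ i j, inner ℝ (X ω i) (X ω j) ∈ Set.Icc (0 : ℝ) 1)
    (hn : 0 < n) (hnd : 2 * d ≤ n) (hK : c + 4 ≤ K) :
    μ.real {ω | ∃ i k, K * √n * √(Real.log n) ≤
      |(centeredAdjacency r (X ω) (A ω) *ᵥ fun j => X ω j k) i|} ≤ (n : ℝ) ^ (-(c + 1)) := by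
  set L := Real.log n with hLdef
  have hL : 0 ≤ L := Real.log_natCast_nonneg n
  have hn' : (0 : ℝ) < n := by exact_mod_cast hn
  have hexp : (n : ℝ) = Real.exp L := (Real.exp_log hn').symm
  have hsqrt : 0 < √(n : ℝ) := Real.sqrt_pos.mpr hn'
  have ht1 : √L / √n ≤ 1 := (div_le_one hsqrt).mpr (Real.sqrt_le_sqrt (Real.log_le_self hn'.le))
  have hvariance : (√L / √n) ^ 2 * (n * r) = L * r := by
    rw [div_pow, Real.sq_sqrt hL, Real.sq_sqrt hn'.le]
    field_simp
  have hdeviation : √L / √n * (K * √n * √L) = K * L := by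
    field_simp
    rw [Real.sq_sqrt hL, mul_comm]
  refine (h.measureReal_abs_mulVec_coord_ge_le hr0 hr1 hX (by positivity) ht1 _).trans ?_
  rw [hvariance, hdeviation]
  calc (n : ℝ) * (d * (2 * Real.exp (L * r - K * L)))
      = n * ((2 * d : ℕ) * Real.exp (L * r - K * L)) := by
        push_cast
        ring
    _ ≤ n * (n * Real.exp (L * 1 - (c + 4) * L)) := by gcongr
    _ = (n : ℝ) ^ (-(c + 1)) := by
        rw [natCast_rpow_eq_exp_mul_log hn, ← hLdef]
        nth_rw 1 2 [hexp]
        rw [← Real.exp_add, ← Real.exp_add]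
        ring_nf

end NoiseBounds

section SparseAndDenseRegimes

variable {n d : ℕ} {r c : ℝ} {Ω : Type*} [MeasurableSpace Ω] {μ : Measure Ω}
  [IsProbabilityMeasure μ] {F : Measure (EuclideanSpace ℝ (Fin d))}
  {X : Ω → Fin n → EuclideanSpace ℝ (Fin d)} {A : Ω → Matrix (Fin n) (Fin n) ℝ}

lemma two_mul_sq_add_le_sub_one_pow_four {c L : ℝ} (hc : 0 ≤ c) (hL : 6 + c ≤ L) :
    2 * L ^ 2 + (c + 1) * L ≤ (L - 1) ^ 4 := by
  calc 2 * L ^ 2 + (c + 1) * L ≤ 3 * L ^ 2 := by nlinarith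
    _ ≤ 5 ^ 2 * (L / 2) ^ 2 := by nlinarith [sq_nonneg L]
    _ ≤ (L - 1) ^ 2 * (L - 1) ^ 2 := by gcongr <;> linarith
    _ = (L - 1) ^ 4 := by ring

lemma IsRDPG.measureReal_not_errorBound_le_of_sparse (h : IsRDPG μ F r X A) (hr0 : 0 < r)
    (hr1 : r ≤ 1) (hX : ∀ᵐ ω ∂μ, ∀ i j, inner ℝ (X ω i) (X ω j) ∈ Set.Icc (0 : ℝ) 1) (hd : 1 ≤ d)
    (hn : 0 < n) (hc : 0 ≤ c) (hL : 6 + c ≤ Real.log n) (hsparse : n * r ≤ Real.log n ^ 2) :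
    μ.real {ω | ¬EmbeddingErrorBound 1 r (X ω) (A ω)} ≤ (n : ℝ) ^ (-c) := by
  set L := Real.log n with hLdef
  set D := 2 * (n * r) + (c + 1) * L with hD
  have hexp : (n : ℝ) = Real.exp L := (Real.exp_log (by exact_mod_cast hn)).symm
  have hDL : D ≤ (L - 1) ^ 4 := by linarith [two_mul_sq_add_le_sub_one_pow_four hc hL]
  calc μ.real {ω | ¬EmbeddingErrorBound 1 r (X ω) (A ω)}
      ≤ μ.real {ω | ∃ i, D ≤ ∑ j, A ω i j} := by
        refine measureReal_mono_of_ae_imp (hX.mono fun ω hω => ?_)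
        contrapose!
        exact fun hdegree => embeddingErrorBound_of_degree_le hd hr0 hr1 hn (h.isAdjacency ω)
          (fun i => norm_le_one_of_inner_self_le_one (hω i i).2) (by linarith) hsparse
          fun i => (hdegree i).le.trans hDL
    _ ≤ n * Real.exp (2 * (n * r) - D) := h.measureReal_degree_ge_le hr0.le hr1 hX D
    _ = (n : ℝ) ^ (-c) := by
        rw [natCast_rpow_eq_exp_mul_log hn, ← hLdef]
        nth_rw 1 [hexp]
        rw [← Real.exp_add, hD]
        ring_nf

/-- The constant in the bounds on the centered adjacency matrix that fail with probability at most
`n ^ (-(c + 1))`: the first term of the maximum serves its rows, the second one its norm. -/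
noncomputable def noiseConst (c : ℝ) : ℝ := max (c + 4) (4 * Real.exp ((c + 2) / 2))

lemma noiseConst_nonneg (c : ℝ) : 0 ≤ noiseConst c :=
  le_max_of_le_right (by positivity)

open scoped Matrix.Norms.L2Operator in
lemma embeddingErrorBound_of_dense {x : Fin n → EuclideanSpace ℝ (Fin d)}
    {a : Matrix (Fin n) (Fin n) ℝ} {M : Matrix (Fin d) (Fin d) ℝ} {K δ : ℝ} (hd : 1 ≤ d)
    (hr0 : 0 ≤ r) (hr1 : r ≤ 1) (ha : IsAdjacency a) (hx : ∀ i, ‖x i‖ ≤ 1) (hK : 0 ≤ K)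
    (hδ : 0 < δ) (hM : ∀ u : Fin d → ℝ, 2 * δ * (u ⬝ᵥ u) ≤ u ⬝ᵥ (M *ᵥ u))
    (hlog : 1 ≤ Real.log n) (hdense : Real.log n ^ 2 ≤ n * r)
    (hdeviation : ∀ j k, |∑ i, x i j * x i k - n * M j k| ≤ n * (δ / d))
    (hnorm : ‖centeredAdjacency r x a‖ ≤ K * √(n * r) * √(Real.log n))
    (hrow : ∀ i k, |(centeredAdjacency r x a *ᵥ fun j => x j k) i| ≤ K * √n * √(Real.log n))
    (hKδ : 6 * (√d * K + 1) ≤ δ * √(Real.log n))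
    (hKδ' : 6 * (√d * K + 1) < δ ^ 2 * √(Real.log n))
    (hC : rowErrorConst (√d * K + 1) δ ≤ Real.log n) : EmbeddingErrorBound 1 r x a := by
  have hlog_sqrt : √(Real.log n) ^ 2 = Real.log n := Real.sq_sqrt (by linarith)
  have hcard : Fintype.card (Fin d) * (δ / d) ≤ δ := by
    rw [Fintype.card_fin, mul_div_cancel₀ _ (by positivity)]
  refine embeddingErrorBound_of_spectral hd hr0 hr1 ha hx hK hδ (Real.one_le_sqrt.mpr hlog)
    hlog_sqrt rfl (hlog_sqrt.trans_le (Real.le_sqrt_of_sq_le hdense)) (fun u => ?_) hnorm hrow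
    hKδ hKδ' (hC.trans_eq hlog_sqrt.symm)
  have hcoercive := scaledPositions_gram_coercive (x := x) hr0 (by positivity) hM hcard
    (by simpa only [Fintype.card_fin] using hdeviation) u
  rwa [Fintype.card_fin] at hcoercive

lemma three_mul_rpow_neg_le {a c : ℝ} (ha : 3 ≤ a) : 3 * a ^ (-(c + 1)) ≤ a ^ (-c) := by
  have ha0 : 0 < a := by linarith
  calc 3 * a ^ (-(c + 1)) ≤ a * a ^ (-(c + 1)) := by gcongr
    _ = a ^ (-c) := by
        nth_rw 1 [← Real.rpow_one a]
        rw [← Real.rpow_add ha0]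
        ring_nf

open scoped Matrix.Norms.L2Operator in
lemma IsRDPG.measureReal_not_errorBound_le_of_dense (h : IsRDPG μ F r X A) (hr0 : 0 < r)
    (hr1 : r ≤ 1) (hX : ∀ᵐ ω ∂μ, ∀ i j, inner ℝ (X ω i) (X ω j) ∈ Set.Icc (0 : ℝ) 1)
    (hF : ∀ᵐ x ∂F, ‖x‖ ≤ 1) (hd : 1 ≤ d) {δ : ℝ} (hδ : 0 < δ)
    (hM : ∀ u : Fin d → ℝ, 2 * δ * (u ⬝ᵥ u) ≤ u ⬝ᵥ (secondMoment F *ᵥ u))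
    (hc : 0 ≤ c) (hL : 4 ≤ Real.log n) (hdense : Real.log n ^ 2 ≤ n * r) (hn : 3 ≤ n)
    (hnd : 2 * d ≤ n)
    (hgram : d ^ 2 * (2 * Real.exp (-(n * (δ / d) ^ 2) / 2)) ≤ (n : ℝ) ^ (-(c + 1)))
    (hKδ : 6 * (√d * noiseConst c + 1) ≤ δ * √(Real.log n))
    (hKδ' : 6 * (√d * noiseConst c + 1) < δ ^ 2 * √(Real.log n))
    (hC : rowErrorConst (√d * noiseConst c + 1) δ ≤ Real.log n) :
    μ.real {ω | ¬EmbeddingErrorBound 1 r (X ω) (A ω)} ≤ (n : ℝ) ^ (-c) := by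
  set K := noiseConst c
  set badGram :=
    {ω | ∃ j k, n * (δ / d) ≤ |∑ i, X ω i j * X ω i k - n * secondMoment F j k|}
  set badNorm := {ω | K * √(n * r) * √(Real.log n) < ‖centeredAdjacency r (X ω) (A ω)‖}
  set badRow := {ω | ∃ i k, K * √n * √(Real.log n) ≤
    |(centeredAdjacency r (X ω) (A ω) *ᵥ fun j => X ω j k) i|}
  have hgram' : μ.real badGram ≤ (n : ℝ) ^ (-(c + 1)) :=
    (h.measureReal_gram_ge_le hF (by positivity)).trans hgram
  have hnorm : μ.real badNorm ≤ (n : ℝ) ^ (-(c + 1)) :=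
    h.measureReal_norm_centeredAdjacency_gt_le hr0 hr1 hX (by omega) hL hdense (by linarith)
      (le_max_right _ _)
  have hrow : μ.real badRow ≤ (n : ℝ) ^ (-(c + 1)) :=
    h.measureReal_abs_mulVec_coord_gt_le hr0.le hr1 hX (by omega) hnd (le_max_left _ _)
  have hinclusion : ∀ᵐ ω ∂μ, ¬EmbeddingErrorBound 1 r (X ω) (A ω) →
      ω ∈ badGram ∪ badNorm ∪ badRow := by
    refine hX.mono fun ω hω => ?_
    contrapose!
    simp only [Set.mem_union, not_or, badGram, badNorm, badRow, Set.mem_ofPred_eq]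
    push Not
    rintro ⟨⟨hdeviation, hnorm⟩, hrow⟩
    exact embeddingErrorBound_of_dense hd hr0.le hr1 (h.isAdjacency ω)
      (fun i => norm_le_one_of_inner_self_le_one (hω i i).2) (noiseConst_nonneg c) hδ hM
      (by linarith) hdense (fun j k => (hdeviation j k).le) hnorm (fun i k => (hrow i k).le)
      hKδ hKδ' hC
  calc μ.real {ω | ¬EmbeddingErrorBound 1 r (X ω) (A ω)}
      ≤ μ.real (badGram ∪ badNorm ∪ badRow) := measureReal_mono_of_ae_imp hinclusion
    _ ≤ μ.real badGram + μ.real badNorm + μ.real badRow :=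
        (measureReal_union_le _ _).trans (by gcongr; exact measureReal_union_le _ _)
    _ ≤ 3 * (n : ℝ) ^ (-(c + 1)) := by linarith
    _ ≤ (n : ℝ) ^ (-c) := three_mul_rpow_neg_le (by exact_mod_cast hn)

end SparseAndDenseRegimes

section Asymptotics
open Filter

lemma eventually_mul_exp_le_rpow (a b c : ℝ) (hb : 0 < b) :
    ∀ᶠ n : ℕ in atTop, a * Real.exp (-(b * n)) ≤ (n : ℝ) ^ (-c) := by
  have hlim := ((tendsto_rpow_mul_exp_neg_mul_atTop_nhds_zero c b hb).const_mul a).comp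
    tendsto_natCast_atTop_atTop
  rw [mul_zero] at hlim
  filter_upwards [hlim.eventually (gt_mem_nhds one_pos), eventually_gt_atTop 0] with n hlt hn
  have hn' : (0 : ℝ) < n := by exact_mod_cast hn
  rw [Real.rpow_neg hn'.le, ← one_div, le_div_iff₀ (by positivity)]
  refine le_trans (le_of_eq ?_) hlt.le
  rw [Function.comp_apply, neg_mul]
  ring

lemma asympAlmostSurely_of_eventually_measureReal_compl_le {Ω : ℕ → Type*}
    [∀ n, MeasurableSpace (Ω n)] {μ : ∀ n, Measure (Ω n)} [∀ n, IsProbabilityMeasure (μ n)]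
    {E : ∀ n, Set (Ω n)}
    (h : ∀ c : ℝ, 0 < c → ∀ᶠ n : ℕ in atTop, (μ n).real (E n)ᶜ ≤ (n : ℝ) ^ (-c)) :
    AsympAlmostSurely μ E := fun c hc => by
  obtain ⟨n₀, hn₀⟩ := eventually_atTop.mp (h c hc)
  refine ⟨n₀, fun n hn η hη _ => ?_⟩
  have htotal := measureReal_union_le (μ := μ n) (E n) (E n)ᶜ
  rw [Set.union_compl_self, probReal_univ] at htotal
  linarith [hn₀ n hn.le]

lemma IsRDPG.ae_forall {n d : ℕ} {r : ℝ} {Ω : Type*} [MeasurableSpace Ω] {μ : Measure Ω}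
    {F : Measure (EuclideanSpace ℝ (Fin d))} {X : Ω → Fin n → EuclideanSpace ℝ (Fin d)}
    {A : Ω → Matrix (Fin n) (Fin n) ℝ} (h : IsRDPG μ F r X A)
    {p : EuclideanSpace ℝ (Fin d) → Prop} (hp : ∀ᵐ x ∂F, p x) : ∀ᵐ ω ∂μ, ∀ i, p (X ω i) :=
  ae_all_iff.mpr fun i =>
    ae_of_ae_map (h.measurable_pos i).aemeasurable ((h.law_pos i).symm ▸ hp)

lemma embeddingErrorBound_of_dim_zero {n : ℕ} {C : ℝ} (hC : 0 ≤ C) (r : ℝ)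
    (x : Fin n → EuclideanSpace ℝ (Fin 0)) (a : Matrix (Fin n) (Fin n) ℝ) :
    EmbeddingErrorBound C r x a := fun Xhat _ => by
  refine ⟨1, one_mem _, fun i => ?_⟩
  rw [Subsingleton.elim (Xhat i - _) 0, norm_zero]
  positivity

lemma eventually_measureReal_not_errorBound_le {d : ℕ} (hd : 1 ≤ d)
    {F : Measure (EuclideanSpace ℝ (Fin d))} [IsFiniteMeasure F] (hF : ∀ᵐ x ∂F, ‖x‖ ≤ 1)
    (hrank : (secondMoment F).rank = d) {ρ : ℕ → ℝ} (hρ : ∀ n, 0 < ρ n ∧ ρ n ≤ 1)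
    {Ω : ℕ → Type*} [∀ n, MeasurableSpace (Ω n)] {μ : ∀ n, Measure (Ω n)}
    [∀ n, IsProbabilityMeasure (μ n)] {X : ∀ n, Ω n → Fin n → EuclideanSpace ℝ (Fin d)}
    {A : ∀ n, Ω n → Matrix (Fin n) (Fin n) ℝ} (h : ∀ n, IsRDPG (μ n) F (ρ n) (X n) (A n))
    (hX : ∀ n, ∀ᵐ ω ∂μ n, ∀ i j, inner ℝ (X n ω i) (X n ω j) ∈ Set.Icc (0 : ℝ) 1)
    {c : ℝ} (hc : 0 ≤ c) :
    ∀ᶠ n : ℕ in atTop,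
      (μ n).real {ω | ¬EmbeddingErrorBound 1 (ρ n) (X n ω) (A n ω)} ≤ (n : ℝ) ^ (-c) := by
  obtain ⟨δ', hδ', hM'⟩ := exists_pos_mul_dotProduct_self_le (posSemidef_secondMoment hF)
    (by rwa [Fintype.card_fin])
  obtain ⟨δ, rfl⟩ : ∃ δ, δ' = 2 * δ := ⟨δ' / 2, by ring⟩
  have hδ : 0 < δ := by linarith
  have hlog : Tendsto (fun n : ℕ => Real.log n) atTop atTop :=
    Real.tendsto_log_atTop.comp tendsto_natCast_atTop_atTop
  have hsqrt : Tendsto (fun n : ℕ => √(Real.log n)) atTop atTop :=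
    Real.tendsto_sqrt_atTop.comp hlog
  filter_upwards [hlog.eventually_ge_atTop (6 + c), eventually_ge_atTop 3,
    eventually_ge_atTop (2 * d),
    eventually_mul_exp_le_rpow (d ^ 2 * 2) ((δ / d) ^ 2 / 2) (c + 1) (by positivity),
    (hsqrt.const_mul_atTop hδ).eventually_ge_atTop (6 * (√d * noiseConst c + 1)),
    (hsqrt.const_mul_atTop (pow_pos hδ 2)).eventually_gt_atTop (6 * (√d * noiseConst c + 1)),
    hlog.eventually_ge_atTop (rowErrorConst (√d * noiseConst c + 1) δ)]
    with n hlogn hn hnd hgram hKδ hKδ' hC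
  rcases le_total ((n : ℝ) * ρ n) (Real.log n ^ 2) with hsparse | hdense
  · exact (h n).measureReal_not_errorBound_le_of_sparse (hρ n).1 (hρ n).2 (hX n) hd (by omega) hc
      hlogn hsparse
  · refine (h n).measureReal_not_errorBound_le_of_dense (hρ n).1 (hρ n).2 (hX n) hF hd hδ hM' hc
      (by linarith) hdense hn hnd ?_ hKδ hKδ' hC
    rwa [← mul_assoc, show -(n * (δ / d) ^ 2) / 2 = -((δ / d) ^ 2 / 2 * n) by ring]

end Asymptotics

theorem mainTheorem2 :
    ∃ C : ℝ, 0 < C ∧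
      ∀ (d : ℕ) (𝒳 : Set (EuclideanSpace ℝ (Fin d)))
        (F : Measure (EuclideanSpace ℝ (Fin d))) [IsProbabilityMeasure F]
        (ρ : ℕ → ℝ) (Ω : ℕ → Type*) [∀ n, MeasurableSpace (Ω n)]
        (μ : ∀ n, Measure (Ω n)) [∀ n, IsProbabilityMeasure (μ n)]
        (X : ∀ n, Ω n → Fin n → EuclideanSpace ℝ (Fin d))
        (A : ∀ n, Ω n → Matrix (Fin n) (Fin n) ℝ),
        (∀ x ∈ 𝒳, ∀ y ∈ 𝒳, inner ℝ x y ∈ Set.Icc (0 : ℝ) 1) →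
        (∀ᵐ x ∂F, x ∈ 𝒳) →
        (secondMoment F).rank = d →
        (∀ n, 0 < ρ n ∧ ρ n ≤ 1) →
        (∀ n, IsRDPG (μ n) F (ρ n) (X n) (A n)) →
        AsympAlmostSurely μ
          (fun n => {ω | EmbeddingErrorBound C (ρ n) (X n ω) (A n ω)}) := by
  refine ⟨1, one_pos, fun d 𝒳 F _ ρ Ω _ μ _ X A h𝒳 hF𝒳 hrank hρ hR => ?_⟩
  refine asympAlmostSurely_of_eventually_measureReal_compl_le fun c hc => ?_
  rcases Nat.eq_zero_or_pos d with rfl | hd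
  · have hempty : ∀ n, {ω | EmbeddingErrorBound 1 (ρ n) (X n ω) (A n ω)}ᶜ = ∅ := fun n =>
      Set.compl_empty_iff.mpr
        (Set.eq_univ_of_forall fun ω => embeddingErrorBound_of_dim_zero zero_le_one _ _ _)
    simp only [hempty, measureReal_empty]
    exact .of_forall fun n => by positivity
  · have hF : ∀ᵐ x ∂F, ‖x‖ ≤ 1 :=
      hF𝒳.mono fun x hx => norm_le_one_of_inner_self_le_one (h𝒳 x hx x hx).2
    have hX : ∀ n, ∀ᵐ ω ∂μ n, ∀ i j, inner ℝ (X n ω i) (X n ω j) ∈ Set.Icc (0 : ℝ) 1 := fun n =>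
      ((hR n).ae_forall hF𝒳).mono fun ω hω i j => h𝒳 _ (hω i) _ (hω j)
    exact eventually_measureReal_not_errorBound_le hd hF hrank hρ hR hX hc.le
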